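/- **Theorem (Boltzmann–Hamel equations for optimal dynamic control).** Let $0\le m\le n$. Greek indices run over $1,\dots,m$ (constrained), capital indices over $m+1,\dots,n$ (unconstrained), lower-case indices over $1,\dots,n$; repeated indices are summed. Let $U\subseteq\mathbb R^n$ be an open coordinate domain, $L(q,\dot q)$ a smooth Lagrangian on $U\times\mathbb R^n$, and $\Psi(q)=(\Psi^j_i(q))$ a smooth invertible $n\times n$ matrix on $U$ with inverse $\Phi$, whose first $m$ rows define the nonholonomic constraints $\Psi^\sigma_i(q)\dot q^i=0$. Put $$u^j=\Psi^j_i\dot q^i,\quad a^j=\dot u^j,\quad \jmath^j=\dot a^j,\quad \frac{\partial f}{\partial\theta^k}=\frac{\partial f}{\partial q^j}\Phi^j_k,\quad \gamma^s_{pk}=\Big(\frac{\partial\Psi^s_i}{\partial q^j}-\frac{\partial\Psi^s_j}{\partial q^i}\Big)\Phi^i_p\Phi^j_k,\quad \mathscr L(q,u)=L(q,\Phi(q)u).$$ The system has $n-m$ controls $Q_I$ and obeys the dynamic Boltzmann–Hamel equations $$\frac{d}{dt}\frac{\partial\mathscr L}{\partial u^I}-\frac{\partial\mathscr L}{\partial\theta^I}-\frac{\partial\mathscr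 L}{\partial u^j}\gamma^j_{KI}u^K=Q_I,\qquad \dot q^i=\Phi^i_Ju^J,$$ evaluated at $u^\sigma=0$ after taking partial derivatives. Expanding the time derivative with $\dot q^i=\Phi^i_Ju^J$, $\dot u^A=a^A$ gives the controls as functions $Q_I(q,u^A,a^A)$. Let $g(q,\dot q,Q)$ be a smooth cost integrand and $C(q,u,a)=g(q,\Phi(q)u,Q(q,u,a))$, a function of $q$, $u^A$, $a^A$ only. Along a curve set $$\kappa_J=\frac{\partial C}{\partial u^J}-\frac{d}{dt}\frac{\partial C}{\partial a^J}.$$ (i) Let $t_0<t_1$, let $q$ be a $C^4$ curve in $U$ on $[t_0,t_1]$ and $\mu=(\mu_\sigma)$ a $C^1$ function. Then $(q,\mu)$ is an extremal of $\int_{t_0}^{t_1}\big(C(q,u,a)+\mu_\sigma u^\sigma\big)\,dt$, i.e. the first variation vanishes for all $C^4$ variations of $q$ that keep $q$ and $\dot q$ fixed at $t_0,t_1$ and all $C^1$ variations of $\mu$, if and only if on $[t_0,t_1]$ $$-\frac{\partial C}{\partial\theta^A}+\dot\kappa_A-\kappa_J\gamma^J_{SA}u^S=\mu_\tau\gamma^\tau_{SA}u^S,$$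 $$-\frac{\partial C}{\partial\theta^\sigma}-\kappa_J\gamma^J_{S\sigma}u^S=\mu_\tau\gamma^\tau_{S\sigma}u^S-\dot\mu_\sigma,$$ $$\dot q^i=\Phi^i_Su^S .$$ (ii) Let $R$ be the set of states $(q,u^A,a^A,\jmath^A,\mu_\sigma)$ with $q\in U$ and $\det\big(\partial^2C/\partial a^A\partial a^B\big)\ne0$; it is an open subset of a space of dimension $4n-2m$. There are smooth functions $J$ and $M$ on $R$ such that, for curves with state in $R$, with $q$ of class $C^4$ and $\mu$ of class $C^1$, the equations in (i) are equivalent to the system of $4n-2m$ first-order ordinary differential equations $$\dot q^i=\Phi^i_Su^S,\quad \dot u^A=a^A,\quad \dot a^A=\jmath^A,\quad \dot\jmath^A=J^A(q,u,a,\jmath,\mu),\quad \dot\mu_\sigma=M_\sigma(q,u,a,\jmath,\mu).$$ The system is minimal: every state in $R$ at any given time is attained by a local solution of the equations in (i), and two solutions on a common interval with states in $R$ that have the same state at one time coincide. (iii) Along any $C^4$ curve in $U$ with $\dot q^i=\Phi^i_Su^S$, control forces $Q_I(t)$ satisfy the dynamic Boltzmann–Hamel equations if and only if they are given by the algebraic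 relations $Q_I(t)=Q_I(q,u,a)$, and then $g(q,\dot q,Q)=C(q,u,a)$. -/

import Mathlib

open scoped ContDiff Matrix

noncomputable section

namespace BoltzmannHamel

/-- Indices `1, …, n` with `n = m + r`.  The left summand holds the constrained (Greek) indices
`1, …, m`, the right summand the unconstrained (capital) indices `m + 1, …, n`. -/
abbrev Idx (m r : ℕ) : Type := Fin m ⊕ Fin r

/-- Coordinate vectors `q`, velocities `q̇`, and vectors `(u¹, …, uⁿ)` of all quasi-velocities. -/
abbrev Conf (m r : ℕ) : Type := Idx m r → ℝ

/-- Vectors with unconstrained components only, such as `u^A`, `a^A`, `Q_A`. -/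
abbrev Free (r : ℕ) : Type := Fin r → ℝ

/-- Multiplier vectors `μ_σ`. -/
abbrev Mult (m : ℕ) : Type := Fin m → ℝ

/-- The partial derivative `∂f/∂x^i` at `x`. -/
def pderiv {ι : Type} [Fintype ι] [DecidableEq ι] (f : (ι → ℝ) → ℝ) (x : ι → ℝ) (i : ι) : ℝ :=
  fderiv ℝ f x (Pi.single i 1)

/-- The vector of all quasi-components whose constrained components vanish. -/
def embed {m r : ℕ} (v : Free r) : Conf m r := Sum.elim 0 v

/-- A nonholonomic mechanical system with `m` linear time-independent constraints
`a^σ_i(q) q̇^i = 0` on a coordinate domain `U`, with further one-forms `b^A_i` completing the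
constraint forms to a quasi-basis, and with unconstrained Lagrangian `L(q, q̇)`. -/
structure System (m r : ℕ) where
  /-- the coordinate domain -/
  U : Set (Conf m r)
  isOpen_U : IsOpen U
  /-- the constraint matrix `a^σ_i(q)` -/
  constr : Conf m r → Matrix (Fin m) (Idx m r) ℝ
  /-- the remaining rows of the matrix `Ψ(q)` -/
  compl : Conf m r → Matrix (Fin r) (Idx m r) ℝ
  /-- the Lagrangian `L(q, q̇)` -/
  L : Conf m r → Conf m r → ℝ
  smooth_constr : ∀ σ i, ContDiffOn ℝ ∞ (fun q => constr q σ i) U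
  smooth_compl : ∀ A i, ContDiffOn ℝ ∞ (fun q => compl q A i) U
  smooth_L : ContDiffOn ℝ ∞ (fun z : Conf m r × Conf m r => L z.1 z.2) (U ×ˢ Set.univ)
  invertible : ∀ q ∈ U, IsUnit (Matrix.fromRows (constr q) (compl q)).det

namespace System

variable {m r : ℕ} (S : System m r)

/-- The matrix `Ψ^j_i(q)`, whose first `m` rows are the constraints. -/
def Psi (q : Conf m r) : Matrix (Idx m r) (Idx m r) ℝ := Matrix.fromRows (S.constr q) (S.compl q)

/-- The inverse matrix `Φ^i_j(q)`. -/
def Phi (q : Conf m r) : Matrix (Idx m r) (Idx m r) ℝ := (S.Psi q)⁻¹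

/-- The Hamel coefficients `γ^s_{pk} = (∂Ψ^s_i/∂q^j - ∂Ψ^s_j/∂q^i) Φ^i_p Φ^j_k`. -/
def hamel (q : Conf m r) (s p k : Idx m r) : ℝ :=
  ∑ i, ∑ j, (pderiv (fun x => S.Psi x s i) q j - pderiv (fun x => S.Psi x s j) q i) *
    S.Phi q i p * S.Phi q j k

/-- The derivative `∂f/∂θ^k = (∂f/∂q^j) Φ^j_k` along the quasi-basis. -/
def thetaDeriv (f : Conf m r → ℝ) (q : Conf m r) (k : Idx m r) : ℝ :=
  ∑ j, pderiv f q j * S.Phi q j k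

/-- `γ^s_{Sk} u^S`, summed over the unconstrained index `S`. -/
def hamelContr (q : Conf m r) (u : Free r) (s k : Idx m r) : ℝ :=
  ∑ K : Fin r, S.hamel q s (Sum.inr K) k * u K

/-! ### Quasi-velocities along a curve -/

/-- The quasi-velocities `u^j = Ψ^j_i q̇^i` of a curve. -/
def quasiVel (q : ℝ → Conf m r) (t : ℝ) : Conf m r := S.Psi (q t) *ᵥ deriv q t

/-- The unconstrained quasi-velocities `u^A`. -/
def freeVel (q : ℝ → Conf m r) (t : ℝ) : Free r := fun A => S.quasiVel q t (Sum.inr A)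

/-- The unconstrained quasi-accelerations `a^A = du^A/dt`. -/
def freeAcc (q : ℝ → Conf m r) : ℝ → Free r := deriv (S.freeVel q)

/-- The unconstrained quasi-jerks `da^A/dt`. -/
def freeJerk (q : ℝ → Conf m r) : ℝ → Free r := deriv (S.freeAcc q)

/-- The kinematic relations `q̇^i = Φ^i_S u^S`, with `S` unconstrained. -/
def Kinematic (q : ℝ → Conf m r) (t : ℝ) : Prop :=
  deriv q t = S.Phi (q t) *ᵥ embed (S.freeVel q t)

/-! ### The dynamic Boltzmann-Hamel equations -/

/-- The unconstrained Lagrangian `ℒ(q, u) = L(q, Φ(q) u)` in quasi-velocities. -/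
def quasiL (q u : Conf m r) : ℝ := S.L q (S.Phi q *ᵥ u)

/-- `∂ℒ/∂u^j`, evaluated where the constrained quasi-velocities vanish. -/
def momentum (q : Conf m r) (u : Free r) (j : Idx m r) : ℝ :=
  pderiv (fun v => S.quasiL q v) (embed u) j

/-- The terms `- ∂ℒ/∂θ^I - (∂ℒ/∂u^j) γ^j_{KI} u^K` of the Boltzmann-Hamel equations. -/
def bhTerms (q : Conf m r) (u : Free r) (I : Fin r) : ℝ :=
  - S.thetaDeriv (fun x => S.quasiL x (embed u)) q (Sum.inr I)
    - ∑ j, S.momentum q u j * S.hamelContr q u j (Sum.inr I)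

/-- The dynamic Boltzmann-Hamel equations
`d/dt ∂ℒ/∂u^I - ∂ℒ/∂θ^I - (∂ℒ/∂u^j) γ^j_{KI} u^K = Q_I` at time `t`
for a curve `q` and control forces `Q_I(t)`. -/
def DynamicBH (q : ℝ → Conf m r) (Q : ℝ → Free r) (t : ℝ) : Prop :=
  ∀ I : Fin r,
    deriv (fun τ => S.momentum (q τ) (S.freeVel q τ) (Sum.inr I)) t
      + S.bhTerms (q t) (S.freeVel q t) I = Q t I

/-- The control forces `Q_I(q, u, a)` that the dynamic Boltzmann-Hamel equations prescribe: the
time derivative of `∂ℒ/∂u^I` is expanded by the chain rule with `q̇^i = Φ^i_S u^S` and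
`du^S/dt = a^S`. -/
def controlForce (q : Conf m r) (u a : Free r) : Free r := fun I =>
  fderiv ℝ (fun z : Conf m r × Free r => S.momentum z.1 z.2 (Sum.inr I)) (q, u)
      (S.Phi q *ᵥ embed u, a)
    + S.bhTerms q u I

/-- The cost integrand `C(q, u, a) = g(q, q̇(q, u), Q(q, u, a))` belonging to `g(q, q̇, Q)`. -/
def cost (g : Conf m r → Conf m r → Free r → ℝ) (q : Conf m r) (u a : Free r) : ℝ :=
  g q (S.Phi q *ᵥ embed u) (S.controlForce q u a)

/-! ### Extremals of the augmented cost -/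

/-- `∫ (C(q, u, a) + μ_σ u^σ) dt` over `[t₀, t₁]`. -/
def augmentedCost (C : Conf m r → Free r → Free r → ℝ) (t₀ t₁ : ℝ)
    (q : ℝ → Conf m r) (μ : ℝ → Mult m) : ℝ :=
  ∫ t in t₀..t₁, (C (q t) (S.freeVel q t) (S.freeAcc q t)
    + ∑ σ : Fin m, μ t σ * S.quasiVel q t (Sum.inl σ))

/-- `w s t` is a proper variation of the curve `q` on `[t₀, t₁]`, keeping the end points and the
end velocities fixed. -/
structure IsProperVariation (t₀ t₁ : ℝ) (q : ℝ → Conf m r) (w : ℝ → ℝ → Conf m r) : Prop where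
  contDiff : ContDiff ℝ 4 (fun p : ℝ × ℝ => w p.1 p.2)
  base : ∀ t, w 0 t = q t
  left : ∀ s, w s t₀ = q t₀
  right : ∀ s, w s t₁ = q t₁
  left_vel : ∀ s, deriv (w s) t₀ = deriv q t₀
  right_vel : ∀ s, deriv (w s) t₁ = deriv q t₁
  mem : ∃ ε > 0, ∀ s ∈ Set.Icc (-ε) ε, ∀ t ∈ Set.Icc t₀ t₁, w s t ∈ S.U

/-- `(q, μ)` is an extremal of the augmented cost: its first variation vanishes for all proper
variations of `q` and all variations of the multipliers. -/
def IsExtremal (C : Conf m r → Free r → Free r → ℝ) (t₀ t₁ : ℝ)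
    (q : ℝ → Conf m r) (μ : ℝ → Mult m) : Prop :=
  ∀ (w : ℝ → ℝ → Conf m r) (ν : ℝ → ℝ → Mult m),
    S.IsProperVariation t₀ t₁ q w →
    ContDiff ℝ 1 (fun p : ℝ × ℝ => ν p.1 p.2) → (∀ t, ν 0 t = μ t) →
    HasDerivAt (fun s => S.augmentedCost C t₀ t₁ (w s) (ν s)) 0 0

/-! ### The Boltzmann-Hamel equations for optimal dynamic control -/

/-- `κ_J = ∂C/∂u^J - d/dt ∂C/∂a^J` along a curve. -/
def kappa (C : Conf m r → Free r → Free r → ℝ) (q : ℝ → Conf m r) (t : ℝ) (J : Fin r) : ℝ :=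
  pderiv (fun v => C (q t) v (S.freeAcc q t)) (S.freeVel q t) J
    - deriv (fun τ => pderiv (fun b => C (q τ) (S.freeVel q τ) b) (S.freeAcc q τ) J) t

/-- `∂C/∂θ^k` along a curve. -/
def costTheta (C : Conf m r → Free r → Free r → ℝ) (q : ℝ → Conf m r) (t : ℝ)
    (k : Idx m r) : ℝ :=
  S.thetaDeriv (fun x => C x (S.freeVel q t) (S.freeAcc q t)) (q t) k

/-- The Boltzmann-Hamel equations for optimal dynamic control at time `t`. -/
structure OptimalBH (C : Conf m r → Free r → Free r → ℝ)
    (q : ℝ → Conf m r) (μ : ℝ → Mult m) (t : ℝ) : Prop where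
  /-- `-∂C/∂θ^A + dκ_A/dt - κ_J γ^J_{SA} u^S = μ_τ γ^τ_{SA} u^S` -/
  free : ∀ A : Fin r,
    - S.costTheta C q t (Sum.inr A) + deriv (fun τ => S.kappa C q τ A) t
      - ∑ J : Fin r, S.kappa C q t J * S.hamelContr (q t) (S.freeVel q t) (Sum.inr J) (Sum.inr A)
    = ∑ τ : Fin m, μ t τ * S.hamelContr (q t) (S.freeVel q t) (Sum.inl τ) (Sum.inr A)
  /-- `-∂C/∂θ^σ - κ_J γ^J_{Sσ} u^S = μ_τ γ^τ_{Sσ} u^S - dμ_σ/dt` -/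
  constrained : ∀ σ : Fin m,
    - S.costTheta C q t (Sum.inl σ)
      - ∑ J : Fin r, S.kappa C q t J * S.hamelContr (q t) (S.freeVel q t) (Sum.inr J) (Sum.inl σ)
    = ∑ τ : Fin m, μ t τ * S.hamelContr (q t) (S.freeVel q t) (Sum.inl τ) (Sum.inl σ)
      - deriv (fun τ => μ τ σ) t
  /-- `q̇^i = Φ^i_S u^S` -/
  kinematic : S.Kinematic q t

end System

/-! ### The first-order system -/

/-- The unknowns `q^i`, `u^A`, `a^A`, the quasi-jerks, and `μ_σ` of the first-order system. -/
abbrev State (m r : ℕ) : Type := Conf m r × Free r × Free r × Free r × Mult m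

/-- The matrix `∂²C/∂a^A∂a^B`. -/
def accHessian {m r : ℕ} (C : Conf m r → Free r → Free r → ℝ) (q : Conf m r) (u a : Free r) :
    Matrix (Fin r) (Fin r) ℝ :=
  Matrix.of fun A B => pderiv (fun b => pderiv (fun c => C q u c) b A) a B

namespace System

variable {m r : ℕ} (S : System m r)

/-- The state `(q, u, a, jerk, μ)` of a curve with multipliers at time `t`. -/
def stateOf (q : ℝ → Conf m r) (μ : ℝ → Mult m) (t : ℝ) : State m r :=
  (q t, S.freeVel q t, S.freeAcc q t, S.freeJerk q t, μ t)

/-- The states at which `∂²C/∂a^A∂a^B` is nonsingular. -/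
def regularStates (C : Conf m r → Free r → Free r → ℝ) : Set (State m r) :=
  {z | z.1 ∈ S.U ∧ (accHessian C z.1 z.2.1 z.2.2.1).det ≠ 0}

/-- The right-hand side of the first-order system `q̇^i = Φ^i_S u^S`, `du/dt = a`,
`da/dt = jerk`, `d(jerk)/dt = J`, `dμ/dt = M`. -/
def firstOrderField (J : State m r → Free r) (M : State m r → Mult m) (z : State m r) :
    State m r :=
  (S.Phi z.1 *ᵥ embed z.2.1, z.2.2.1, z.2.2.2.1, J z, M z)

end System

end BoltzmannHamel

end

namespace BoltzmannHamel

/-! ### Smoothness of the coefficient functions -/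

section General

variable {E F : Type*} [NormedAddCommGroup E] [NormedSpace ℝ E]
  [NormedAddCommGroup F] [NormedSpace ℝ F]

/-! Write `δθ = Ψ δq` for the quasi-variation of a curve. The constraints enter through the
multipliers, so all `n` components of `δθ` are free in the interior of the interval. Symmetry of
second derivatives gives `δa = d(δu)/dt`, while differentiating `Ψ` along and across the curve gives
the transpositional relation `d(δθ^s)/dt = δu^s - γ^s_{pk} u^p δθ^k` (`hasDerivAt_quasiVar`).

For (i), let `λ = (μ, κ)`. Two integrations by parts, packed into the single identity
`hasDerivAt_boundaryTerm`, turn the first variation into the integral of `E_k δθ^k + δμ_σ u^σ`,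
where `E_k = ∂C/∂θ^k - dλ_k/dt + λ_s γ^s_{pk} u^p`. The boundary terms vanish because `δq` and `δu`
do at the end points. The fundamental lemma of the calculus of variations then gives `u^σ = 0` and
`E_k = 0`. Once `u^σ = 0`, the sum over `p` reduces to the unconstrained indices and `E_k = 0` is
the stated system (`optimalBH_iff`, `isExtremal_iff`).

For (ii), the kinematic relation makes `κ` a function of `(q, u, a, jerk)`, affine in the jerk with
linear part `-∂²C/∂a∂a`. Where this Hessian is invertible, the unconstrained equations can be solved
for the derivative of the jerk; the constrained ones give `dμ/dt` directly (`optimalBH_iff_rates`).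
The result is a smooth autonomous equation on the open set of regular states, so minimality is local
existence and uniqueness for such equations.

For (iii), the chain rule expands `d/dt ∂ℒ/∂u^I` along a kinematic curve (`dynamicBH_iff`). -/

theorem contDiffOn_det {ι : Type*} [Fintype ι] [DecidableEq ι] {k : WithTop ℕ∞}
    {A : E → Matrix ι ι ℝ} {s : Set E} (hA : ∀ i j, ContDiffOn ℝ k (fun x => A x i j) s) :
    ContDiffOn ℝ k (fun x => (A x).det) s := by
  simp only [Matrix.det_apply]
  refine ContDiffOn.sum fun σ _ => ContDiffOn.const_smul _ ?_
  exact contDiffOn_prod fun i _ => hA _ _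

/-- Cramer's rule: an entry of the inverse is `det⁻¹` times the determinant of the matrix with one
row replaced by a standard basis vector. -/
theorem contDiffOn_inv_apply {ι : Type*} [Fintype ι] [DecidableEq ι] {k : WithTop ℕ∞}
    {A : E → Matrix ι ι ℝ} {s : Set E} (hA : ∀ i j, ContDiffOn ℝ k (fun x => A x i j) s)
    (hdet : ∀ x ∈ s, (A x).det ≠ 0) (i j : ι) :
    ContDiffOn ℝ k (fun x => (A x)⁻¹ i j) s := by
  simp only [Matrix.inv_def, Matrix.smul_apply, Ring.inverse_eq_inv', smul_eq_mul,
    Matrix.adjugate_apply]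
  refine ((contDiffOn_det hA).inv hdet).mul (contDiffOn_det fun k l => ?_)
  by_cases h : k = j
  · subst h
    simpa using contDiffOn_const
  · simpa [Matrix.updateRow_ne h] using hA k l

theorem contDiffOn_mulVec {ι κ : Type*} [Fintype ι] [Fintype κ] {k : WithTop ℕ∞}
    {A : E → Matrix ι κ ℝ} {v : E → κ → ℝ} {s : Set E}
    (hA : ∀ i j, ContDiffOn ℝ k (fun x => A x i j) s) (hv : ContDiffOn ℝ k v s) :
    ContDiffOn ℝ k (fun x => A x *ᵥ v x) s := by
  refine contDiffOn_pi.2 fun i => ?_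
  simp only [Matrix.mulVec, dotProduct]
  exact ContDiffOn.sum fun j _ => (hA i j).mul (contDiffOn_pi.1 hv j)

theorem contDiffOn_fderiv_apply {k l : WithTop ℕ∞} {f : E → F} {v : E → E} {s : Set E}
    (hf : ContDiffOn ℝ l f s) (hs : IsOpen s) (hkl : k + 1 ≤ l) (hv : ContDiffOn ℝ k v s) :
    ContDiffOn ℝ k (fun x => fderiv ℝ f x (v x)) s :=
  (hf.fderiv_of_isOpen hs hkl).clm_apply hv

theorem pderiv_comp {ι : Type} [Fintype ι] [DecidableEq ι] {f : E → ℝ} {φ : (ι → ℝ) → E}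
    {φ' : (ι → ℝ) →L[ℝ] E} {x : ι → ℝ} (hf : DifferentiableAt ℝ f (φ x))
    (hφ : HasFDerivAt φ φ' x) (i : ι) :
    pderiv (fun y => f (φ y)) x i = fderiv ℝ f (φ x) (φ' (Pi.single i 1)) := by
  have h := (hf.hasFDerivAt.comp x hφ).fderiv
  exact congrArg (fun l => l (Pi.single i 1)) h

theorem fderiv_eq_sum_pderiv {ι : Type} [Fintype ι] [DecidableEq ι] (f : (ι → ℝ) → ℝ)
    (x v : ι → ℝ) : fderiv ℝ f x v = ∑ i, pderiv f x i * v i := by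
  conv_lhs => rw [← Finset.univ_sum_single v]
  rw [map_sum]
  refine Finset.sum_congr rfl fun i _ => ?_
  have : (Pi.single i (v i) : ι → ℝ) = v i • Pi.single i 1 := by
    ext j; by_cases h : j = i
    · subst h; simp
    · simp [h]
  rw [this, map_smul, smul_eq_mul, mul_comm, pderiv]

theorem contDiffOn_pderiv {ι : Type} [Fintype ι] [DecidableEq ι] {f : (ι → ℝ) → ℝ}
    {s : Set (ι → ℝ)} (hf : ContDiffOn ℝ ∞ f s) (hs : IsOpen s) (i : ι) :
    ContDiffOn ℝ ∞ (fun x => pderiv f x i) s :=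
  contDiffOn_fderiv_apply hf hs (by simp) contDiffOn_const

theorem _root_.ContDiffOn.differentiableAt_of_mem {k : WithTop ℕ∞} {f : E → F} {s : Set E}
    (hf : ContDiffOn ℝ k f s) (hs : IsOpen s) (hk : k ≠ 0) {x : E} (hx : x ∈ s) :
    DifferentiableAt ℝ f x :=
  (hf.contDiffAt (hs.mem_nhds hx)).differentiableAt hk

/-- A partial derivative in the first of two variables. -/
theorem pderiv_fst {ι : Type} [Fintype ι] [DecidableEq ι] {f : (ι → ℝ) × E → ℝ} {x : ι → ℝ}
    {y : E} (hf : DifferentiableAt ℝ f (x, y)) (i : ι) :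
    pderiv (fun x => f (x, y)) x i = fderiv ℝ f (x, y) (Pi.single i 1, 0) := by
  have := pderiv_comp (φ := fun x => (x, y)) hf
    ((hasFDerivAt_id x).prodMk (hasFDerivAt_const y x)) i
  simpa using this

/-- A partial derivative in the second of two variables. -/
theorem pderiv_snd {ι : Type} [Fintype ι] [DecidableEq ι] {f : E × (ι → ℝ) → ℝ} {x : E}
    {y : ι → ℝ} (hf : DifferentiableAt ℝ f (x, y)) (i : ι) :
    pderiv (fun y => f (x, y)) y i = fderiv ℝ f (x, y) (0, Pi.single i 1) := by
  have := pderiv_comp (φ := fun y => (x, y)) hf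
    ((hasFDerivAt_const x y).prodMk (hasFDerivAt_id y)) i
  simpa using this

end General

/-- The linear map underlying `embed`. -/
noncomputable def embedL {m r : ℕ} : Free r →L[ℝ] Conf m r :=
  ContinuousLinearMap.pi (Sum.elim 0 fun A => ContinuousLinearMap.proj A)

theorem embedL_apply {m r : ℕ} (v : Free r) : (embedL v : Conf m r) = embed v := by
  ext i; cases i <;> simp [embedL, embed]

theorem contDiff_embed {m r : ℕ} {k : WithTop ℕ∞} : ContDiff ℝ k (embed : Free r → Conf m r) := by
  have : (embed : Free r → Conf m r) = embedL := funext fun v => (embedL_apply v).symm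
  rw [this]
  exact ContinuousLinearMap.contDiff _

namespace System

variable {m r : ℕ} (S : System m r)

theorem contDiffOn_Psi (i j : Idx m r) : ContDiffOn ℝ ∞ (fun q => S.Psi q i j) S.U := by
  cases i with
  | inl σ => simpa [Psi] using S.smooth_constr σ j
  | inr A => simpa [Psi] using S.smooth_compl A j

theorem isUnit_det_Psi {q : Conf m r} (hq : q ∈ S.U) : IsUnit (S.Psi q).det := S.invertible q hq

theorem contDiffOn_Phi (i j : Idx m r) : ContDiffOn ℝ ∞ (fun q => S.Phi q i j) S.U :=
  contDiffOn_inv_apply S.contDiffOn_Psi (fun _ hq => (S.isUnit_det_Psi hq).ne_zero) i j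

theorem Psi_mul_Phi {q : Conf m r} (hq : q ∈ S.U) : S.Psi q * S.Phi q = 1 :=
  Matrix.mul_nonsing_inv _ (S.isUnit_det_Psi hq)

theorem Phi_mul_Psi {q : Conf m r} (hq : q ∈ S.U) : S.Phi q * S.Psi q = 1 :=
  Matrix.nonsing_inv_mul _ (S.isUnit_det_Psi hq)

theorem contDiffOn_hamel (s p k : Idx m r) : ContDiffOn ℝ ∞ (fun q => S.hamel q s p k) S.U := by
  unfold hamel
  refine ContDiffOn.sum fun i _ => ContDiffOn.sum fun j _ => ?_
  exact (((contDiffOn_pderiv (S.contDiffOn_Psi s i) S.isOpen_U j).sub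
    (contDiffOn_pderiv (S.contDiffOn_Psi s j) S.isOpen_U i)).mul (S.contDiffOn_Phi i p)).mul
    (S.contDiffOn_Phi j k)

section Domain

theorem isOpen_domain {X : Type*} [TopologicalSpace X] : IsOpen (S.U ×ˢ (Set.univ : Set X)) :=
  S.isOpen_U.prod isOpen_univ

variable {X : Type*} [NormedAddCommGroup X] [NormedSpace ℝ X]

theorem contDiffOn_fst_domain {F : Type*} [NormedAddCommGroup F] [NormedSpace ℝ F]
    {k : WithTop ℕ∞} {f : Conf m r → F} (hf : ContDiffOn ℝ k f S.U) :
    ContDiffOn ℝ k (fun z : Conf m r × X => f z.1) (S.U ×ˢ (Set.univ : Set X)) :=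
  hf.comp contDiffOn_fst fun _ hz => hz.1

theorem contDiffOn_thetaDeriv {f : Conf m r × X → ℝ} (hf : ContDiffOn ℝ ∞ f (S.U ×ˢ Set.univ))
    (k : Idx m r) :
    ContDiffOn ℝ ∞ (fun z : Conf m r × X => S.thetaDeriv (fun x => f (x, z.2)) z.1 k)
      (S.U ×ˢ Set.univ) := by
  unfold thetaDeriv
  refine ContDiffOn.sum fun j _ => ContDiffOn.mul ?_ (S.contDiffOn_fst_domain (S.contDiffOn_Phi j k))
  refine (contDiffOn_fderiv_apply (v := fun _ => (Pi.single j 1, 0)) hf S.isOpen_domain (by simp)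
    contDiffOn_const).congr fun z hz => ?_
  exact pderiv_fst (hf.differentiableAt_of_mem S.isOpen_domain (by simp) hz) j

theorem contDiffOn_hamelContr {u : X → Free r} (hu : ContDiff ℝ ∞ u) (s k : Idx m r) :
    ContDiffOn ℝ ∞ (fun z : Conf m r × X => S.hamelContr z.1 (u z.2) s k) (S.U ×ˢ Set.univ) := by
  unfold hamelContr
  refine ContDiffOn.sum fun K _ => (S.contDiffOn_fst_domain (S.contDiffOn_hamel s _ k)).mul ?_
  exact ((contDiff_pi.1 hu K).comp contDiff_snd).contDiffOn

theorem contDiffOn_Phi_mulVec {u : X → Conf m r} (hu : ContDiff ℝ ∞ u) :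
    ContDiffOn ℝ ∞ (fun z : Conf m r × X => S.Phi z.1 *ᵥ u z.2) (S.U ×ˢ Set.univ) :=
  contDiffOn_mulVec (fun i j => S.contDiffOn_fst_domain (S.contDiffOn_Phi i j))
    (hu.comp contDiff_snd).contDiffOn

end Domain

theorem contDiffOn_quasiL :
    ContDiffOn ℝ ∞ (fun z : Conf m r × Conf m r => S.quasiL z.1 z.2) (S.U ×ˢ Set.univ) :=
  S.smooth_L.comp (contDiffOn_fst.prodMk (S.contDiffOn_Phi_mulVec contDiff_id))
    fun _ hz => ⟨hz.1, trivial⟩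

theorem contDiffOn_momentum (j : Idx m r) :
    ContDiffOn ℝ ∞ (fun z : Conf m r × Free r => S.momentum z.1 z.2 j) (S.U ×ˢ Set.univ) := by
  have h := contDiffOn_fderiv_apply (v := fun _ => (0, Pi.single j 1)) S.contDiffOn_quasiL
    S.isOpen_domain (k := ∞) (by simp) contDiffOn_const
  refine (h.comp (f := fun z : Conf m r × Free r => (z.1, embed z.2))
    (contDiff_fst.prodMk (contDiff_embed.comp contDiff_snd)).contDiffOn
    fun z hz => ⟨hz.1, trivial⟩).congr fun z hz => ?_
  exact pderiv_snd (f := fun z : Conf m r × Conf m r => S.quasiL z.1 z.2)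
    (S.contDiffOn_quasiL.differentiableAt_of_mem S.isOpen_domain (by simp) ⟨hz.1, trivial⟩) j

theorem contDiffOn_bhTerms (I : Fin r) :
    ContDiffOn ℝ ∞ (fun z : Conf m r × Free r => S.bhTerms z.1 z.2 I) (S.U ×ˢ Set.univ) := by
  unfold bhTerms
  refine ContDiffOn.sub (ContDiffOn.neg ?_) (ContDiffOn.sum fun j _ =>
    (S.contDiffOn_momentum j).mul (S.contDiffOn_hamelContr contDiff_id j _))
  exact (S.contDiffOn_thetaDeriv S.contDiffOn_quasiL (Sum.inr I)).comp
    (f := fun z : Conf m r × Free r => (z.1, embed z.2))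
    (contDiff_fst.prodMk (contDiff_embed.comp contDiff_snd)).contDiffOn
    fun z hz => ⟨hz.1, trivial⟩

theorem contDiffOn_controlForce :
    ContDiffOn ℝ ∞ (fun z : Conf m r × Free r × Free r => S.controlForce z.1 z.2.1 z.2.2)
      (S.U ×ˢ Set.univ) := by
  rw [contDiffOn_pi]
  intro I
  have hp : ContDiffOn ℝ ∞ (fun z : Conf m r × Free r × Free r => (z.1, z.2.1))
      (S.U ×ˢ Set.univ) := (contDiff_fst.prodMk (contDiff_fst.comp contDiff_snd)).contDiffOn
  have hmaps : Set.MapsTo (fun z : Conf m r × Free r × Free r => (z.1, z.2.1))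
      (S.U ×ˢ Set.univ) (S.U ×ˢ Set.univ) := fun z hz => ⟨hz.1, trivial⟩
  have h₁ := ((S.contDiffOn_momentum (Sum.inr I)).fderiv_of_isOpen S.isOpen_domain
    (m := ∞) (by simp)).comp hp hmaps
  have h₂ : ContDiffOn ℝ ∞ (fun z : Conf m r × Free r × Free r =>
      (S.Phi z.1 *ᵥ embed z.2.1, z.2.2)) (S.U ×ˢ Set.univ) :=
    (S.contDiffOn_Phi_mulVec (contDiff_embed.comp contDiff_fst)).prodMk
      (contDiff_snd.comp contDiff_snd).contDiffOn
  have h₃ := (S.contDiffOn_bhTerms I).comp hp hmaps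
  have h₄ := h₁.clm_apply h₂
  have h₅ := h₄.add h₃
  refine h₅.congr fun z hz => ?_
  rfl

theorem contDiffOn_cost {g : Conf m r → Conf m r → Free r → ℝ}
    (hg : ContDiffOn ℝ ∞ (fun z : Conf m r × Conf m r × Free r => g z.1 z.2.1 z.2.2)
      (S.U ×ˢ Set.univ)) :
    ContDiffOn ℝ ∞ (fun z : Conf m r × Free r × Free r => S.cost g z.1 z.2.1 z.2.2)
      (S.U ×ˢ Set.univ) :=
  hg.comp (contDiffOn_fst.prodMk
    ((S.contDiffOn_Phi_mulVec (contDiff_embed.comp contDiff_fst)).prodMk S.contDiffOn_controlForce))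
    fun _ hz => ⟨hz.1, trivial⟩

end System

end BoltzmannHamel

namespace BoltzmannHamel

section General

variable {E : Type*} [NormedAddCommGroup E] [NormedSpace ℝ E]

theorem fderiv_prod_apply {ι : Type} [Fintype ι] [DecidableEq ι] {f : (ι → ℝ) × E → ℝ}
    {x : ι → ℝ} {y : E} (hf : DifferentiableAt ℝ f (x, y)) (v : ι → ℝ) (w : E) :
    fderiv ℝ f (x, y) (v, w) = ∑ i, pderiv (fun x => f (x, y)) x i * v i
      + fderiv ℝ (fun y => f (x, y)) y w := by
  have h₁ := (hf.hasFDerivAt.comp (f := fun x => (x, y)) x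
    ((hasFDerivAt_id x).prodMk (hasFDerivAt_const y x))).fderiv
  have h₂ := (hf.hasFDerivAt.comp (f := fun y => (x, y)) y
    ((hasFDerivAt_const x y).prodMk (hasFDerivAt_id y))).fderiv
  rw [← fderiv_eq_sum_pderiv]
  have e₁ : fderiv ℝ (fun x => f (x, y)) x v = fderiv ℝ f (x, y) (v, 0) :=
    (congrArg (fun l => l v) h₁).trans (by simp)
  have e₂ : fderiv ℝ (fun y => f (x, y)) y w = fderiv ℝ f (x, y) (0, w) :=
    (congrArg (fun l => l w) h₂).trans (by simp)
  rw [e₁, e₂, ← map_add]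
  simp

end General

/-! ### The cost integrand -/

section Cost

variable {m r : ℕ}

/-- The cost integrand as a function on a product space. -/
noncomputable def uncurryCost (C : Conf m r → Free r → Free r → ℝ)
    (z : Conf m r × Free r × Free r) : ℝ :=
  C z.1 z.2.1 z.2.2

/-- `∂C/∂u^J` as a function on a product space. -/
noncomputable def costVel (C : Conf m r → Free r → Free r → ℝ) (J : Fin r)
    (z : Conf m r × Free r × Free r) : ℝ :=
  pderiv (fun v => C z.1 v z.2.2) z.2.1 J

/-- `∂C/∂a^J` as a function on a product space. -/
noncomputable def costAcc (C : Conf m r → Free r → Free r → ℝ) (J : Fin r)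
    (z : Conf m r × Free r × Free r) : ℝ :=
  pderiv (fun b => C z.1 z.2.1 b) z.2.2 J

variable (S : System m r) {C : Conf m r → Free r → Free r → ℝ}

namespace System

theorem contDiffOn_costVel (hC : ContDiffOn ℝ ∞ (uncurryCost C) (S.U ×ˢ Set.univ)) (J : Fin r) :
    ContDiffOn ℝ ∞ (costVel C J) (S.U ×ˢ Set.univ) := by
  refine (contDiffOn_fderiv_apply (v := fun _ => (0, Pi.single J 1, 0)) hC S.isOpen_domain
    (by simp) contDiffOn_const).congr fun z hz => ?_
  have := pderiv_comp (φ := fun v => (z.1, v, z.2.2)) (x := z.2.1)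
    (hC.differentiableAt_of_mem S.isOpen_domain (by simp) hz)
    ((hasFDerivAt_const z.1 z.2.1).prodMk
      ((hasFDerivAt_id z.2.1).prodMk (hasFDerivAt_const z.2.2 z.2.1))) J
  exact this.trans (by simp)

theorem contDiffOn_costAcc (hC : ContDiffOn ℝ ∞ (uncurryCost C) (S.U ×ˢ Set.univ)) (J : Fin r) :
    ContDiffOn ℝ ∞ (costAcc C J) (S.U ×ˢ Set.univ) := by
  refine (contDiffOn_fderiv_apply (v := fun _ => (0, 0, Pi.single J 1)) hC S.isOpen_domain
    (by simp) contDiffOn_const).congr fun z hz => ?_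
  have := pderiv_comp (φ := fun v => (z.1, z.2.1, v)) (x := z.2.2)
    (hC.differentiableAt_of_mem S.isOpen_domain (by simp) hz)
    ((hasFDerivAt_const z.1 z.2.2).prodMk
      ((hasFDerivAt_const z.2.1 z.2.2).prodMk (hasFDerivAt_id z.2.2))) J
  exact this.trans (by simp)

theorem fderiv_uncurryCost (hC : ContDiffOn ℝ ∞ (uncurryCost C) (S.U ×ˢ Set.univ))
    {z : Conf m r × Free r × Free r} (hz : z.1 ∈ S.U) (w : Conf m r × Free r × Free r) :
    fderiv ℝ (uncurryCost C) z w = ∑ i, pderiv (fun x => C x z.2.1 z.2.2) z.1 i * w.1 i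
      + (∑ J, costVel C J z * w.2.1 J + ∑ J, costAcc C J z * w.2.2 J) := by
  have hd := hC.differentiableAt_of_mem S.isOpen_domain (by simp) (x := z) ⟨hz, trivial⟩
  have h₁ := fderiv_prod_apply (f := uncurryCost C) (x := z.1) (y := z.2) hd w.1 w.2
  have hd' : DifferentiableAt ℝ (fun y : Free r × Free r => uncurryCost C (z.1, y)) z.2 :=
    DifferentiableAt.comp (g := uncurryCost C) z.2 hd
      ((differentiableAt_const z.1).prodMk differentiableAt_id)
  have h₂ := fderiv_prod_apply (f := fun y : Free r × Free r => uncurryCost C (z.1, y))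
    (x := z.2.1) (y := z.2.2) hd' w.2.1 w.2.2
  rw [fderiv_eq_sum_pderiv] at h₂
  exact h₁.trans (congrArg _ h₂)

/-- The row vector of `θ`-derivatives is the gradient times `Φ`, and `Φ Ψ = 1`. In the first
variation this trades `δq` for `δθ`. -/
theorem sum_thetaDeriv_mul {q : Conf m r} (hq : q ∈ S.U) (f : Conf m r → ℝ) (η : Conf m r) :
    ∑ k, S.thetaDeriv f q k * (S.Psi q *ᵥ η) k = ∑ i, pderiv f q i * η i := by
  have h : ∀ v, ∑ k, S.thetaDeriv f q k * v k = (pderiv f q) ⬝ᵥ (S.Phi q *ᵥ v) := fun v => by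
    rw [Matrix.dotProduct_mulVec]; rfl
  rw [h, Matrix.mulVec_mulVec, S.Phi_mul_Psi hq, Matrix.one_mulVec]
  rfl

end System

end Cost

/-! ### Quantities along a curve -/

namespace System

variable {m r : ℕ} (S : System m r) {C : Conf m r → Free r → Free r → ℝ}
  {q : ℝ → Conf m r}

theorem isOpen_preimage_U (hq : ContDiff ℝ 4 q) : IsOpen (q ⁻¹' S.U) :=
  S.isOpen_U.preimage hq.continuous

theorem contDiffOn_comp_curve {F : Type*} [NormedAddCommGroup F] [NormedSpace ℝ F]
    {f : Conf m r → F} (hf : ContDiffOn ℝ ∞ f S.U) (hq : ContDiff ℝ 4 q) {k : WithTop ℕ∞}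
    (hk : k ≤ 4) : ContDiffOn ℝ k (fun t => f (q t)) (q ⁻¹' S.U) :=
  (hf.of_le (hk.trans ENat.LEInfty.out)).comp (hq.of_le hk).contDiffOn fun _ ht => ht

/-- Start of the derivative count: with `q` of class `C⁴`, `u` is `C³`, `a` is `C²`, the jerk is
`C¹`, and `κ` is `C¹`, so `dκ/dt` exists. The domain `q ⁻¹' U` is open and contains `[t₀, t₁]` in
the applications, so two-sided derivatives are available at the end points too. -/
theorem contDiffOn_quasiVel (hq : ContDiff ℝ 4 q) :
    ContDiffOn ℝ 3 (S.quasiVel q) (q ⁻¹' S.U) := by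
  refine contDiffOn_mulVec (fun i j => S.contDiffOn_comp_curve (S.contDiffOn_Psi i j) hq ?_) ?_
  · exact_mod_cast (by norm_num : (3 : ℕ) ≤ 4)
  · exact ((contDiff_succ_iff_deriv (n := 3)).1
      (by simpa [show (3 : WithTop ℕ∞) + 1 = 4 by norm_num] using hq)).2.2.contDiffOn

theorem contDiffOn_freeVel (hq : ContDiff ℝ 4 q) : ContDiffOn ℝ 3 (S.freeVel q) (q ⁻¹' S.U) :=
  contDiffOn_pi.2 fun A => contDiffOn_pi.1 (S.contDiffOn_quasiVel hq) (Sum.inr A)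

theorem contDiffOn_freeAcc (hq : ContDiff ℝ 4 q) : ContDiffOn ℝ 2 (S.freeAcc q) (q ⁻¹' S.U) :=
  (S.contDiffOn_freeVel hq).deriv_of_isOpen (S.isOpen_preimage_U hq) (by norm_num)

theorem contDiffOn_freeJerk (hq : ContDiff ℝ 4 q) : ContDiffOn ℝ 1 (S.freeJerk q) (q ⁻¹' S.U) :=
  (S.contDiffOn_freeAcc hq).deriv_of_isOpen (S.isOpen_preimage_U hq) (by norm_num)

theorem hasDerivAt_curve (hq : ContDiff ℝ 4 q) (t : ℝ) : HasDerivAt q (deriv q t) t :=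
  (hq.differentiable (by norm_num) t).hasDerivAt

theorem hasDerivAt_freeVel (hq : ContDiff ℝ 4 q) {t : ℝ} (ht : q t ∈ S.U) :
    HasDerivAt (S.freeVel q) (S.freeAcc q t) t :=
  ((S.contDiffOn_freeVel hq).differentiableAt_of_mem (S.isOpen_preimage_U hq) (by norm_num)
    ht).hasDerivAt

theorem hasDerivAt_freeAcc (hq : ContDiff ℝ 4 q) {t : ℝ} (ht : q t ∈ S.U) :
    HasDerivAt (S.freeAcc q) (S.freeJerk q t) t :=
  ((S.contDiffOn_freeAcc hq).differentiableAt_of_mem (S.isOpen_preimage_U hq) (by norm_num)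
    ht).hasDerivAt

theorem hasDerivAt_freeJerk (hq : ContDiff ℝ 4 q) {t : ℝ} (ht : q t ∈ S.U) :
    HasDerivAt (S.freeJerk q) (deriv (S.freeJerk q) t) t :=
  ((S.contDiffOn_freeJerk hq).differentiableAt_of_mem (S.isOpen_preimage_U hq) (by norm_num)
    ht).hasDerivAt

/-- The arguments `(q, u, a)` of the cost integrand along a curve. -/
noncomputable def costCurve (q : ℝ → Conf m r) (t : ℝ) : Conf m r × Free r × Free r :=
  (q t, S.freeVel q t, S.freeAcc q t)

theorem contDiffOn_costCurve (hq : ContDiff ℝ 4 q) :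
    ContDiffOn ℝ 2 (S.costCurve q) (q ⁻¹' S.U) :=
  (hq.of_le (by exact_mod_cast (by norm_num : (2 : ℕ) ≤ 4))).contDiffOn.prodMk
    (((S.contDiffOn_freeVel hq).of_le (by exact_mod_cast (by norm_num : (2 : ℕ) ≤ 3))).prodMk
      (S.contDiffOn_freeAcc hq))

theorem hasDerivAt_costCurve (hq : ContDiff ℝ 4 q) {t : ℝ} (ht : q t ∈ S.U) :
    HasDerivAt (S.costCurve q) (deriv q t, S.freeAcc q t, S.freeJerk q t) t :=
  (hasDerivAt_curve hq t).prodMk ((S.hasDerivAt_freeVel hq ht).prodMk (S.hasDerivAt_freeAcc hq ht))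

theorem contDiffOn_comp_costCurve {f : Conf m r × Free r × Free r → ℝ}
    (hf : ContDiffOn ℝ ∞ f (S.U ×ˢ Set.univ)) (hq : ContDiff ℝ 4 q) :
    ContDiffOn ℝ 2 (fun t => f (S.costCurve q t)) (q ⁻¹' S.U) :=
  (hf.of_le ENat.LEInfty.out).comp (S.contDiffOn_costCurve hq) fun _ ht => ⟨ht, trivial⟩

theorem hasDerivAt_comp_costCurve {f : Conf m r × Free r × Free r → ℝ}
    (hf : ContDiffOn ℝ ∞ f (S.U ×ˢ Set.univ)) (hq : ContDiff ℝ 4 q) {t : ℝ} (ht : q t ∈ S.U) :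
    HasDerivAt (fun t => f (S.costCurve q t))
      (fderiv ℝ f (S.costCurve q t) (deriv q t, S.freeAcc q t, S.freeJerk q t)) t :=
  (hf.differentiableAt_of_mem S.isOpen_domain (by simp)
    (x := S.costCurve q t) ⟨ht, trivial⟩).hasFDerivAt.comp_hasDerivAt t
    (S.hasDerivAt_costCurve hq ht)

theorem kappa_eq (C : Conf m r → Free r → Free r → ℝ) (q : ℝ → Conf m r) (t : ℝ) (J : Fin r) :
    S.kappa C q t J = costVel C J (S.costCurve q t)
      - deriv (fun τ => costAcc C J (S.costCurve q τ)) t := rfl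

theorem contDiffOn_kappa (hC : ContDiffOn ℝ ∞ (uncurryCost C) (S.U ×ˢ Set.univ))
    (hq : ContDiff ℝ 4 q) (J : Fin r) :
    ContDiffOn ℝ 1 (fun t => S.kappa C q t J) (q ⁻¹' S.U) :=
  ((S.contDiffOn_comp_costCurve (S.contDiffOn_costVel hC J) hq).of_le (by norm_num)).sub
    ((S.contDiffOn_comp_costCurve (S.contDiffOn_costAcc hC J) hq).deriv_of_isOpen
      (S.isOpen_preimage_U hq) (by norm_num))

/-- Multiplication by `Ψ` turns the relation into `u = embed (freeVel)`, whose unconstrained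
components hold by definition. -/
theorem kinematic_iff {q : ℝ → Conf m r} {t : ℝ} (ht : q t ∈ S.U) :
    S.Kinematic q t ↔ ∀ σ : Fin m, S.quasiVel q t (Sum.inl σ) = 0 := by
  have key : S.Kinematic q t ↔ S.quasiVel q t = embed (S.freeVel q t) := by
    unfold Kinematic quasiVel
    constructor
    · intro h
      conv_lhs => rw [h]
      rw [Matrix.mulVec_mulVec, S.Psi_mul_Phi ht, Matrix.one_mulVec]
    · intro h
      rw [← h, Matrix.mulVec_mulVec, S.Phi_mul_Psi ht, Matrix.one_mulVec]
  rw [key]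
  constructor
  · intro h σ
    rw [h]; rfl
  · intro h
    ext i
    cases i with
    | inl σ => exact h σ
    | inr A => rfl

/-! ### The controls -/

theorem dynamicBH_iff (hq : ContDiff ℝ 4 q) (Q : ℝ → Free r) {t : ℝ} (ht : q t ∈ S.U)
    (hk : S.Kinematic q t) :
    S.DynamicBH q Q t ↔ Q t = S.controlForce (q t) (S.freeVel q t) (S.freeAcc q t) := by
  have hd : ∀ I : Fin r, deriv (fun τ => S.momentum (q τ) (S.freeVel q τ) (Sum.inr I)) t =
      fderiv ℝ (fun z : Conf m r × Free r => S.momentum z.1 z.2 (Sum.inr I)) (q t, S.freeVel q t)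
        (S.Phi (q t) *ᵥ embed (S.freeVel q t), S.freeAcc q t) := fun I => by
    have h := ((S.contDiffOn_momentum (Sum.inr I)).differentiableAt_of_mem S.isOpen_domain
      (by simp) (x := (q t, S.freeVel q t)) ⟨ht, trivial⟩).hasFDerivAt.comp_hasDerivAt t
      ((hasDerivAt_curve hq t).prodMk (S.hasDerivAt_freeVel hq ht))
    -- The kinematic relation replaces the actual velocity by `Φ u`, the direction built into
    -- `controlForce`.
    rw [hk] at h
    exact h.deriv
  unfold DynamicBH
  rw [funext_iff]
  refine forall_congr' fun I => ?_
  rw [hd, eq_comm]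
  rfl

theorem cost_eq_of_dynamicBH (g : Conf m r → Conf m r → Free r → ℝ) (hq : ContDiff ℝ 4 q)
    (Q : ℝ → Free r) {t : ℝ} (ht : q t ∈ S.U) (hk : S.Kinematic q t) (h : S.DynamicBH q Q t) :
    g (q t) (deriv q t) (Q t) = S.cost g (q t) (S.freeVel q t) (S.freeAcc q t) := by
  rw [(S.dynamicBH_iff hq Q ht hk).1 h, hk]
  rfl

end System

end BoltzmannHamel

namespace BoltzmannHamel

/-! ### Functions of two parameters -/

section TwoParameters

variable {E : Type*} [NormedAddCommGroup E] [NormedSpace ℝ E]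

theorem hasDerivAt_slice_snd {f : ℝ × ℝ → E} {s t : ℝ} (hf : DifferentiableAt ℝ f (s, t)) :
    HasDerivAt (fun τ => f (s, τ)) (fderiv ℝ f (s, t) (0, 1)) t :=
  hf.hasFDerivAt.comp_hasDerivAt (f := fun τ => (s, τ)) t
    ((hasDerivAt_const t s).prodMk (hasDerivAt_id t))

theorem hasDerivAt_slice_fst {f : ℝ × ℝ → E} {s t : ℝ} (hf : DifferentiableAt ℝ f (s, t)) :
    HasDerivAt (fun σ => f (σ, t)) (fderiv ℝ f (s, t) (1, 0)) s :=
  hf.hasFDerivAt.comp_hasDerivAt (f := fun σ => (σ, t)) s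
    ((hasDerivAt_id s).prodMk (hasDerivAt_const s t))

/-- The derivative in time of a variation is the variation of the derivative in time. -/
theorem hasDerivAt_fderiv_fst {f : ℝ × ℝ → E} {s t : ℝ} (hf : ContDiffAt ℝ 2 f (s, t)) :
    HasDerivAt (fun τ => fderiv ℝ f (s, τ) (1, 0))
      (fderiv ℝ (fun p => fderiv ℝ f p (0, 1)) (s, t) (1, 0)) t := by
  have hd : DifferentiableAt ℝ (fderiv ℝ f) (s, t) :=
    (hf.fderiv_right (m := 1) (by norm_num)).differentiableAt (by norm_num)
  have hsymm : IsSymmSndFDerivAt ℝ f (s, t) := hf.isSymmSndFDerivAt (by simp)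
  have h := (hasDerivAt_slice_snd hd).clm_apply (hasDerivAt_const t ((1 : ℝ), (0 : ℝ)))
  have e : fderiv ℝ (fun p => fderiv ℝ f p (0, 1)) (s, t) (1, 0)
      = fderiv ℝ (fderiv ℝ f) (s, t) (0, 1) (1, 0) := by
    rw [hsymm.eq, fderiv_clm_apply hd (differentiableAt_const _)]
    simp
  rw [e]
  simpa using h

/-- The parameter derivative is continuous on the compact rectangle `[-ε, ε] × [t₀, t₁]`; its bound
there is a constant dominating function. -/
theorem hasDerivAt_integral_of_contDiffOn {f : ℝ × ℝ → ℝ} {W : Set (ℝ × ℝ)} (hW : IsOpen W)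
    (hf : ContDiffOn ℝ 1 f W) {t₀ t₁ ε : ℝ} (h01 : t₀ ≤ t₁) (hε : 0 < ε)
    (hmem : ∀ s ∈ Set.Icc (-ε) ε, ∀ t ∈ Set.Icc t₀ t₁, (s, t) ∈ W) :
    HasDerivAt (fun s => ∫ t in t₀..t₁, f (s, t)) (∫ t in t₀..t₁, fderiv ℝ f (0, t) (1, 0)) 0 := by
  have hc : ContinuousOn (fun p => fderiv ℝ f p (1, 0)) W :=
    (hf.continuousOn_fderiv_of_isOpen hW le_rfl).clm_apply continuousOn_const
  have hK : IsCompact (Set.Icc (-ε) ε ×ˢ Set.Icc t₀ t₁) := isCompact_Icc.prod isCompact_Icc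
  obtain ⟨c, hcb⟩ := hK.exists_bound_of_continuousOn
    (hc.mono fun p hp => hmem p.1 hp.1 p.2 hp.2)
  have hslice : ∀ s ∈ Set.Icc (-ε) ε, ∀ g : ℝ × ℝ → ℝ, ContinuousOn g W →
      IntervalIntegrable (fun t => g (s, t)) MeasureTheory.volume t₀ t₁ := fun s hs g hg => by
    refine ContinuousOn.intervalIntegrable ?_
    rw [Set.uIcc_of_le h01]
    exact hg.comp (by fun_prop) fun t ht => hmem s hs t ht
  have h0 : (0 : ℝ) ∈ Set.Icc (-ε) ε := ⟨by linarith, hε.le⟩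
  have hsub : Set.uIoc t₀ t₁ ⊆ Set.Icc t₀ t₁ := by
    rw [Set.uIoc_of_le h01]; exact Set.Ioc_subset_Icc_self
  refine (intervalIntegral.hasDerivAt_integral_of_dominated_loc_of_deriv_le
    (F := fun s t => f (s, t)) (F' := fun s t => fderiv ℝ f (s, t) (1, 0)) (bound := fun _ => c)
    (Icc_mem_nhds (by linarith : -ε < 0) hε) ?_ (hslice 0 h0 _ hf.continuousOn)
    (intervalIntegrable_iff.1 (hslice 0 h0 _ hc)).aestronglyMeasurable ?_ intervalIntegrable_const ?_).2
  · filter_upwards [Icc_mem_nhds (by linarith : -ε < 0) hε] with s hs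
    exact (intervalIntegrable_iff.1 (hslice s hs _ hf.continuousOn)).aestronglyMeasurable
  · exact Filter.Eventually.of_forall fun t ht s hs => hcb (s, t) ⟨hs, hsub ht⟩
  · exact Filter.Eventually.of_forall fun t ht s hs => hasDerivAt_slice_fst
      (hf.differentiableAt_of_mem hW one_ne_zero (hmem s hs t (hsub ht)))

end TwoParameters

/-! ### The transposition identity and the Euler–Lagrange coefficients. -/

namespace System

variable {m r : ℕ} (S : System m r) {C : Conf m r → Free r → Free r → ℝ}
  {q : ℝ → Conf m r} {μ : ℝ → Mult m}

/-- `γ^s_{pk} v^p`, summed over all indices `p`. -/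
noncomputable def hamelFull (q v : Conf m r) (s k : Idx m r) : ℝ := ∑ p, S.hamel q s p k * v p

/-- The transposition identity for quasi-velocities. -/
theorem sum_hamelFull_mul {q : Conf m r} (hq : q ∈ S.U) (v η : Conf m r) (s : Idx m r) :
    ∑ k, S.hamelFull q (S.Psi q *ᵥ v) s k * (S.Psi q *ᵥ η) k =
      ∑ i, ((∑ j, pderiv (fun x => S.Psi x s i) q j * η j) * v i
        - (∑ j, pderiv (fun x => S.Psi x s i) q j * v j) * η i) := by
  have hinv : ∀ x : Conf m r, x = S.Phi q *ᵥ (S.Psi q *ᵥ x) := fun x => by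
    rw [Matrix.mulVec_mulVec, S.Phi_mul_Psi hq, Matrix.one_mulVec]
  -- With `Ψ v` and `Ψ η` named `a` and `b`, the substitutions `v = Φ a` and `η = Φ b` do not
  -- rewrite inside them.
  generalize ha : S.Psi q *ᵥ v = a
  generalize hb : S.Psi q *ᵥ η = b
  have hv : ∀ i, v i = ∑ p, S.Phi q i p * a p := fun i => by
    conv_lhs => rw [hinv v, ha]
    rfl
  have hη : ∀ j, η j = ∑ k, S.Phi q j k * b k := fun j => by
    conv_lhs => rw [hinv η, hb]
    rfl
  -- Exchanging the summation indices in the second term produces the antisymmetrised derivative of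
  -- `Ψ` that defines `γ`.
  have e : ∑ i, ((∑ j, pderiv (fun x => S.Psi x s i) q j * η j) * v i
        - (∑ j, pderiv (fun x => S.Psi x s i) q j * v j) * η i) =
      ∑ i, ∑ j, (pderiv (fun x => S.Psi x s i) q j - pderiv (fun x => S.Psi x s j) q i)
        * v i * η j := by
    rw [Finset.sum_sub_distrib]
    simp only [sub_mul, Finset.sum_sub_distrib, Finset.sum_mul]
    congr 1
    · exact Finset.sum_congr rfl fun i _ => Finset.sum_congr rfl fun j _ => by ring
    · rw [Finset.sum_comm]
  rw [e]
  simp only [hv, hη, hamelFull, hamel, Finset.sum_mul, Finset.mul_sum]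
  rw [Finset.sum_congr rfl fun k _ => Finset.sum_comm, Finset.sum_comm]
  refine Finset.sum_congr rfl fun i _ => ?_
  rw [Finset.sum_congr rfl fun k _ => Finset.sum_comm, Finset.sum_comm]
  refine Finset.sum_congr rfl fun j _ => ?_
  refine Finset.sum_congr rfl fun k _ => Finset.sum_congr rfl fun p _ => by ring

/-- The multipliers `μ_σ` together with the momenta `κ_J`. -/
noncomputable def multiplier (C : Conf m r → Free r → Free r → ℝ) (q : ℝ → Conf m r)
    (μ : ℝ → Mult m) (k : Idx m r) (t : ℝ) : ℝ :=
  Sum.elim (fun σ => μ t σ) (fun J => S.kappa C q t J) k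

/-- The coefficient of the `k`-th quasi-variation in the first variation. -/
noncomputable def eulerLagrange (C : Conf m r → Free r → Free r → ℝ) (q : ℝ → Conf m r)
    (μ : ℝ → Mult m) (t : ℝ) (k : Idx m r) : ℝ :=
  S.costTheta C q t k - deriv (S.multiplier C q μ k) t
    + ∑ s, S.multiplier C q μ s t * S.hamelFull (q t) (S.quasiVel q t) s k

theorem contDiffOn_multiplier (hC : ContDiffOn ℝ ∞ (uncurryCost C) (S.U ×ˢ Set.univ))
    (hq : ContDiff ℝ 4 q) (hμ : ContDiff ℝ 1 μ) (k : Idx m r) :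
    ContDiffOn ℝ 1 (S.multiplier C q μ k) (q ⁻¹' S.U) := by
  cases k with
  | inl σ => exact (contDiff_pi.1 hμ σ).contDiffOn
  | inr J => exact S.contDiffOn_kappa hC hq J

theorem continuousOn_eulerLagrange (hC : ContDiffOn ℝ ∞ (uncurryCost C) (S.U ×ˢ Set.univ))
    (hq : ContDiff ℝ 4 q) (hμ : ContDiff ℝ 1 μ) (k : Idx m r) :
    ContinuousOn (fun t => S.eulerLagrange C q μ t k) (q ⁻¹' S.U) := by
  unfold eulerLagrange hamelFull
  refine (ContinuousOn.sub ?_ ?_).add (continuousOn_finsetSum _ fun s _ => ContinuousOn.mul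
    (S.contDiffOn_multiplier hC hq hμ s).continuousOn
    (continuousOn_finsetSum _ fun p _ => ContinuousOn.mul ?_ ?_))
  · exact (S.contDiffOn_comp_costCurve (S.contDiffOn_thetaDeriv hC k) hq).continuousOn
  · exact (S.contDiffOn_multiplier hC hq hμ k).continuousOn_deriv_of_isOpen
      (S.isOpen_preimage_U hq) le_rfl
  · exact (S.contDiffOn_comp_curve (S.contDiffOn_hamel s p k) hq le_rfl).continuousOn
  · exact continuousOn_pi.1 (S.contDiffOn_quasiVel hq).continuousOn p

/-- When the constrained quasi-velocities vanish, `γ^s_{pk} u^p` loses its constrained terms. The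
Euler–Lagrange coefficients at `Sum.inr` and `Sum.inl` indices are then, up to sign, the two
families of equations. -/
theorem optimalBH_iff {t : ℝ} (ht : q t ∈ S.U) :
    S.OptimalBH C q μ t ↔
      (∀ σ : Fin m, S.quasiVel q t (Sum.inl σ) = 0) ∧ ∀ k, S.eulerLagrange C q μ t k = 0 := by
  have hfull : (∀ σ : Fin m, S.quasiVel q t (Sum.inl σ) = 0) → ∀ s k,
      S.hamelFull (q t) (S.quasiVel q t) s k = S.hamelContr (q t) (S.freeVel q t) s k := by
    intro h s k
    simp [hamelFull, hamelContr, Fintype.sum_sum_type, h, freeVel]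
  -- These are equalities of functions of time rather than of values, so they also rewrite under
  -- `deriv`.
  have hfree : S.multiplier C q μ ∘ Sum.inr = fun J τ => S.kappa C q τ J := rfl
  have hconstr : S.multiplier C q μ ∘ Sum.inl = fun σ τ => μ τ σ := rfl
  have hinl := fun σ => congrFun hconstr σ
  have hinr := fun J => congrFun hfree J
  simp only [Function.comp_apply] at hinl hinr
  constructor
  · rintro ⟨h₁, h₂, h₃⟩
    have h₀ := (S.kinematic_iff ht).1 h₃
    refine ⟨h₀, fun k => ?_⟩
    simp only [eulerLagrange, hfull h₀, Fintype.sum_sum_type, hinl, hinr]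
    cases k with
    | inl σ =>
      have := h₂ σ
      rw [hinl]
      linarith
    | inr A =>
      have := h₁ A
      rw [hinr]
      linarith
  · rintro ⟨h₀, h⟩
    simp only [eulerLagrange, hfull h₀, Fintype.sum_sum_type, hinl, hinr] at h
    refine ⟨fun A => ?_, fun σ => ?_, (S.kinematic_iff ht).2 h₀⟩
    · have := h (Sum.inr A)
      rw [hinr] at this
      linarith
    · have := h (Sum.inl σ)
      rw [hinl] at this
      linarith

end System

end BoltzmannHamel

namespace BoltzmannHamel

namespace System

variable {m r : ℕ} (S : System m r) {C : Conf m r → Free r → Free r → ℝ}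

/-! ### Variations of a curve -/

section Variation

variable {w : ℝ → ℝ → Conf m r} {ν : ℝ → ℝ → Mult m}

/-- The parameters at which a variation stays in the coordinate domain. -/
def variationDomain (w : ℝ → ℝ → Conf m r) : Set (ℝ × ℝ) := (fun p : ℝ × ℝ => w p.1 p.2) ⁻¹' S.U

theorem isOpen_variationDomain (hw : ContDiff ℝ 4 (fun p : ℝ × ℝ => w p.1 p.2)) :
    IsOpen (S.variationDomain w) := S.isOpen_U.preimage hw.continuous

theorem contDiff_slice (hw : ContDiff ℝ 4 (fun p : ℝ × ℝ => w p.1 p.2)) (s : ℝ) :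
    ContDiff ℝ 4 (w s) := hw.comp (contDiff_const.prodMk contDiff_id)

theorem deriv_variation (hw : ContDiff ℝ 4 (fun p : ℝ × ℝ => w p.1 p.2)) (s t : ℝ) :
    deriv (w s) t = fderiv ℝ (fun p : ℝ × ℝ => w p.1 p.2) (s, t) (0, 1) :=
  (hasDerivAt_slice_snd (hw.differentiable (by norm_num) (s, t))).deriv

theorem contDiffOn_variedVel (hw : ContDiff ℝ 4 (fun p : ℝ × ℝ => w p.1 p.2)) :
    ContDiffOn ℝ 3 (fun p : ℝ × ℝ => S.quasiVel (w p.1) p.2) (S.variationDomain w) := by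
  have h34 : (3 : WithTop ℕ∞) ≤ 4 := by exact_mod_cast (by norm_num : (3 : ℕ) ≤ 4)
  refine contDiffOn_mulVec (fun i j => ((S.contDiffOn_Psi i j).of_le ENat.LEInfty.out).comp
    (hw.of_le h34).contDiffOn fun p hp => hp) ?_
  simp only [deriv_variation hw]
  exact ((hw.fderiv_right (m := 3) (by norm_num)).clm_apply contDiff_const).contDiffOn

theorem contDiffOn_variedFreeVel (hw : ContDiff ℝ 4 (fun p : ℝ × ℝ => w p.1 p.2)) :
    ContDiffOn ℝ 3 (fun p : ℝ × ℝ => S.freeVel (w p.1) p.2) (S.variationDomain w) :=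
  contDiffOn_pi.2 fun A => contDiffOn_pi.1 (S.contDiffOn_variedVel hw) (Sum.inr A)

/-- As a partial derivative of a function of both parameters, the acceleration inherits joint
smoothness. -/
theorem freeAcc_variation (hw : ContDiff ℝ 4 (fun p : ℝ × ℝ => w p.1 p.2)) {p : ℝ × ℝ}
    (hp : p ∈ S.variationDomain w) :
    S.freeAcc (w p.1) p.2 = fderiv ℝ (fun p : ℝ × ℝ => S.freeVel (w p.1) p.2) p (0, 1) :=
  (hasDerivAt_slice_snd (s := p.1) (t := p.2)
    ((S.contDiffOn_variedFreeVel hw).differentiableAt_of_mem (S.isOpen_variationDomain hw)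
      (by norm_num) hp)).deriv

theorem contDiffOn_variedFreeAcc (hw : ContDiff ℝ 4 (fun p : ℝ × ℝ => w p.1 p.2)) :
    ContDiffOn ℝ 2 (fun p : ℝ × ℝ => S.freeAcc (w p.1) p.2) (S.variationDomain w) :=
  (((S.contDiffOn_variedFreeVel hw).fderiv_of_isOpen (S.isOpen_variationDomain hw)
    (by norm_num)).clm_apply contDiffOn_const).congr fun _ hp => S.freeAcc_variation hw hp

/-- The integrand of the augmented cost on a variation. -/
noncomputable def variedIntegrand (C : Conf m r → Free r → Free r → ℝ) (w : ℝ → ℝ → Conf m r)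
    (ν : ℝ → ℝ → Mult m) (p : ℝ × ℝ) : ℝ :=
  uncurryCost C (S.costCurve (w p.1) p.2)
    + ∑ σ : Fin m, ν p.1 p.2 σ * S.quasiVel (w p.1) p.2 (Sum.inl σ)

theorem contDiffOn_variedIntegrand (hC : ContDiffOn ℝ ∞ (uncurryCost C) (S.U ×ˢ Set.univ))
    (hw : ContDiff ℝ 4 (fun p : ℝ × ℝ => w p.1 p.2))
    (hν : ContDiff ℝ 1 (fun p : ℝ × ℝ => ν p.1 p.2)) :
    ContDiffOn ℝ 1 (S.variedIntegrand C w ν) (S.variationDomain w) := by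
  have hz : ContDiffOn ℝ 1 (fun p : ℝ × ℝ => S.costCurve (w p.1) p.2) (S.variationDomain w) :=
    (hw.of_le (by norm_num)).contDiffOn.prodMk
      (((S.contDiffOn_variedFreeVel hw).of_le (by norm_num)).prodMk
        ((S.contDiffOn_variedFreeAcc hw).of_le (by norm_num)))
  refine ((hC.of_le ENat.LEInfty.out).comp hz fun p hp => ⟨hp, trivial⟩).add
    (ContDiffOn.sum fun σ _ => ?_)
  exact (contDiff_pi.1 hν σ).contDiffOn.mul
    (contDiffOn_pi.1 ((S.contDiffOn_variedVel hw).of_le (by norm_num)) (Sum.inl σ))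

/-- The variation `δq` of the coordinates. -/
noncomputable def varCoord (w : ℝ → ℝ → Conf m r) (t : ℝ) : Conf m r :=
  fderiv ℝ (fun p : ℝ × ℝ => w p.1 p.2) (0, t) (1, 0)

/-- The variation `δu` of the quasi-velocities. -/
noncomputable def varVel (w : ℝ → ℝ → Conf m r) (t : ℝ) : Conf m r :=
  fderiv ℝ (fun p : ℝ × ℝ => S.quasiVel (w p.1) p.2) (0, t) (1, 0)

/-- The variation `δu` of the unconstrained quasi-velocities. -/
noncomputable def varFreeVel (w : ℝ → ℝ → Conf m r) (t : ℝ) : Free r :=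
  fderiv ℝ (fun p : ℝ × ℝ => S.freeVel (w p.1) p.2) (0, t) (1, 0)

/-- The variation of the multipliers. -/
noncomputable def varMult (ν : ℝ → ℝ → Mult m) (t : ℝ) : Mult m :=
  fderiv ℝ (fun p : ℝ × ℝ => ν p.1 p.2) (0, t) (1, 0)

/-- The quasi-variation `δθ`. -/
noncomputable def quasiVar (w : ℝ → ℝ → Conf m r) (t : ℝ) : Conf m r :=
  S.Psi (w 0 t) *ᵥ varCoord w t

theorem hasDerivAt_varied (hw : ContDiff ℝ 4 (fun p : ℝ × ℝ => w p.1 p.2)) (t : ℝ) :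
    HasDerivAt (fun s => w s t) (varCoord w t) 0 :=
  hasDerivAt_slice_fst (hw.differentiable (by norm_num) (0, t))

theorem hasDerivAt_variedVel (hw : ContDiff ℝ 4 (fun p : ℝ × ℝ => w p.1 p.2)) {t : ℝ}
    (ht : w 0 t ∈ S.U) : HasDerivAt (fun s => S.quasiVel (w s) t) (S.varVel w t) 0 :=
  hasDerivAt_slice_fst ((S.contDiffOn_variedVel hw).differentiableAt_of_mem
    (S.isOpen_variationDomain hw) (by norm_num) (x := (0, t)) ht)

theorem hasDerivAt_variedFreeVel (hw : ContDiff ℝ 4 (fun p : ℝ × ℝ => w p.1 p.2)) {t : ℝ}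
    (ht : w 0 t ∈ S.U) : HasDerivAt (fun s => S.freeVel (w s) t) (S.varFreeVel w t) 0 :=
  hasDerivAt_slice_fst ((S.contDiffOn_variedFreeVel hw).differentiableAt_of_mem
    (S.isOpen_variationDomain hw) (by norm_num) (x := (0, t)) ht)

theorem varFreeVel_apply (hw : ContDiff ℝ 4 (fun p : ℝ × ℝ => w p.1 p.2)) {t : ℝ}
    (ht : w 0 t ∈ S.U) (J : Fin r) : S.varFreeVel w t J = S.varVel w t (Sum.inr J) :=
  (hasDerivAt_pi.1 (S.hasDerivAt_variedFreeVel hw ht) J).unique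
    (hasDerivAt_pi.1 (S.hasDerivAt_variedVel hw ht) (Sum.inr J))

theorem differentiableAt_varCoord (hw : ContDiff ℝ 4 (fun p : ℝ × ℝ => w p.1 p.2)) (t : ℝ) :
    DifferentiableAt ℝ (varCoord w) t :=
  (hasDerivAt_fderiv_fst ((hw.of_le (by norm_num)).contDiffAt)).differentiableAt

theorem deriv_varCoord (hw : ContDiff ℝ 4 (fun p : ℝ × ℝ => w p.1 p.2)) (t : ℝ) :
    HasDerivAt (fun s => deriv (w s) t) (deriv (varCoord w) t) 0 := by
  have h := (hasDerivAt_fderiv_fst (s := 0) (t := t)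
    ((hw.of_le (m := 2) (by norm_num)).contDiffAt)).deriv
  change deriv (varCoord w) t = _ at h
  rw [h]
  simp only [deriv_variation hw]
  exact hasDerivAt_slice_fst
    (((hw.fderiv_right (m := 3) (by norm_num)).clm_apply contDiff_const).differentiable
      (by norm_num) (0, t))

/-- This is `d(δu)/dt = δa`, by symmetry of second derivatives. The acceleration is the time partial
of `u` only on the open variation domain, hence the passage through an eventual equality. -/
theorem hasDerivAt_varFreeVel (hw : ContDiff ℝ 4 (fun p : ℝ × ℝ => w p.1 p.2)) {t : ℝ}
    (ht : w 0 t ∈ S.U) : HasDerivAt (S.varFreeVel w)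
      (fderiv ℝ (fun p : ℝ × ℝ => S.freeAcc (w p.1) p.2) (0, t) (1, 0)) t := by
  have hmem : S.variationDomain w ∈ nhds ((0 : ℝ), t) :=
    (S.isOpen_variationDomain hw).mem_nhds ht
  have h := hasDerivAt_fderiv_fst (s := 0) (t := t)
    (((S.contDiffOn_variedFreeVel hw).of_le (m := 2) (by norm_num)).contDiffAt hmem)
  have e : (fun p : ℝ × ℝ => S.freeAcc (w p.1) p.2) =ᶠ[nhds (0, t)]
      fun p => fderiv ℝ (fun p : ℝ × ℝ => S.freeVel (w p.1) p.2) p (0, 1) := by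
    filter_upwards [hmem] with p hp using S.freeAcc_variation hw hp
  rw [e.fderiv_eq]
  exact h

theorem hasDerivAt_variedFreeAcc (hw : ContDiff ℝ 4 (fun p : ℝ × ℝ => w p.1 p.2)) {t : ℝ}
    (ht : w 0 t ∈ S.U) :
    HasDerivAt (fun s => S.freeAcc (w s) t) (deriv (S.varFreeVel w) t) 0 := by
  rw [(S.hasDerivAt_varFreeVel hw ht).deriv]
  exact hasDerivAt_slice_fst ((S.contDiffOn_variedFreeAcc hw).differentiableAt_of_mem
    (S.isOpen_variationDomain hw) (by norm_num) (x := (0, t)) ht)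

theorem hasDerivAt_Psi_comp {c : ℝ → Conf m r} {c' : Conf m r} {s : ℝ} (hc : HasDerivAt c c' s)
    (hs : c s ∈ S.U) (i j : Idx m r) :
    HasDerivAt (fun τ => S.Psi (c τ) i j) (∑ k, pderiv (fun x => S.Psi x i j) (c s) k * c' k) s := by
  rw [← fderiv_eq_sum_pderiv]
  exact ((S.contDiffOn_Psi i j).differentiableAt_of_mem S.isOpen_U (by simp)
    hs).hasFDerivAt.comp_hasDerivAt s hc

/-- The transpositional relations `δu - d(δθ)/dt`. -/
theorem hasDerivAt_quasiVar (hw : ContDiff ℝ 4 (fun p : ℝ × ℝ => w p.1 p.2)) {t : ℝ}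
    (ht : w 0 t ∈ S.U) (s : Idx m r) :
    HasDerivAt (fun τ => S.quasiVar w τ s)
      (S.varVel w t s - ∑ k, S.hamelFull (w 0 t) (S.quasiVel (w 0) t) s k * S.quasiVar w t k) t := by
  have h₁ : HasDerivAt (fun σ => S.quasiVel (w σ) t s)
      (∑ i, ((∑ j, pderiv (fun x => S.Psi x s i) (w 0 t) j * varCoord w t j) * deriv (w 0) t i
        + S.Psi (w 0 t) s i * deriv (varCoord w) t i)) 0 :=
    HasDerivAt.fun_sum (u := Finset.univ) fun i _ =>
      (S.hasDerivAt_Psi_comp (hasDerivAt_varied hw t) ht s i).mul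
      (hasDerivAt_pi.1 (deriv_varCoord hw t) i)
  have h₂ : HasDerivAt (fun τ => S.quasiVar w τ s)
      (∑ i, ((∑ j, pderiv (fun x => S.Psi x s i) (w 0 t) j * deriv (w 0) t j) * varCoord w t i
        + S.Psi (w 0 t) s i * deriv (varCoord w) t i)) t :=
    HasDerivAt.fun_sum (u := Finset.univ) fun i _ => (S.hasDerivAt_Psi_comp
      (hasDerivAt_curve (contDiff_slice hw 0) t) ht s i).mul
      (hasDerivAt_pi.1 (differentiableAt_varCoord hw t).hasDerivAt i)
  -- Both product rules contain the same term `Ψ d(δq)/dt`. What remains of their difference is the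
  -- bracket computed in `sum_hamelFull_mul`.
  have e₁ := (hasDerivAt_pi.1 (S.hasDerivAt_variedVel hw ht) s).unique h₁
  have e₂ := S.sum_hamelFull_mul ht (deriv (w 0) t) (varCoord w t) s
  convert h₂ using 1
  unfold quasiVar
  unfold quasiVel at e₁ ⊢
  rw [e₁, e₂, ← Finset.sum_sub_distrib]
  exact Finset.sum_congr rfl fun i _ => by ring

/-- The boundary term in the first variation. -/
noncomputable def boundaryTerm (C : Conf m r → Free r → Free r → ℝ) (w : ℝ → ℝ → Conf m r)
    (ν : ℝ → ℝ → Mult m) (t : ℝ) : ℝ :=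
  ∑ J, costAcc C J (S.costCurve (w 0) t) * S.varFreeVel w t J
    + ∑ k, S.multiplier C (w 0) (ν 0) k t * S.quasiVar w t k

/-- The part of the first variation that remains after integration by parts. -/
noncomputable def reducedVariation (C : Conf m r → Free r → Free r → ℝ) (w : ℝ → ℝ → Conf m r)
    (ν : ℝ → ℝ → Mult m) (t : ℝ) : ℝ :=
  ∑ k, S.eulerLagrange C (w 0) (ν 0) t k * S.quasiVar w t k
    + ∑ σ, varMult ν t σ * S.quasiVel (w 0) t (Sum.inl σ)

theorem fderiv_variedIntegrand (hC : ContDiffOn ℝ ∞ (uncurryCost C) (S.U ×ˢ Set.univ))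
    (hw : ContDiff ℝ 4 (fun p : ℝ × ℝ => w p.1 p.2))
    (hν : ContDiff ℝ 1 (fun p : ℝ × ℝ => ν p.1 p.2)) {t : ℝ} (ht : w 0 t ∈ S.U) :
    fderiv ℝ (S.variedIntegrand C w ν) (0, t) (1, 0) =
      ∑ k, S.costTheta C (w 0) t k * S.quasiVar w t k
      + (∑ J, costVel C J (S.costCurve (w 0) t) * S.varFreeVel w t J
        + ∑ J, costAcc C J (S.costCurve (w 0) t) * deriv (S.varFreeVel w) t J)
      + ∑ σ, (varMult ν t σ * S.quasiVel (w 0) t (Sum.inl σ)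
        + ν 0 t σ * S.varVel w t (Sum.inl σ)) := by
  have h₁ : HasDerivAt (fun s => S.variedIntegrand C w ν (s, t)) _ 0 := hasDerivAt_slice_fst
    ((S.contDiffOn_variedIntegrand hC hw hν).differentiableAt_of_mem
      (S.isOpen_variationDomain hw) (by norm_num) (x := (0, t)) ht)
  have hz : HasDerivAt (fun s => S.costCurve (w s) t)
      (varCoord w t, S.varFreeVel w t, deriv (S.varFreeVel w) t) 0 :=
    (hasDerivAt_varied hw t).prodMk
      ((S.hasDerivAt_variedFreeVel hw ht).prodMk (S.hasDerivAt_variedFreeAcc hw ht))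
  have h₂ := (hC.differentiableAt_of_mem S.isOpen_domain (by simp)
    (x := S.costCurve (w 0) t) ⟨ht, trivial⟩).hasFDerivAt.comp_hasDerivAt (0 : ℝ) hz
  have hμ : HasDerivAt (fun s => ν s t) (varMult ν t) 0 :=
    hasDerivAt_slice_fst (hν.differentiable (by norm_num) (0, t))
  have h₃ : HasDerivAt (fun s => ∑ σ, ν s t σ * S.quasiVel (w s) t (Sum.inl σ))
      (∑ σ, (varMult ν t σ * S.quasiVel (w 0) t (Sum.inl σ)
        + ν 0 t σ * S.varVel w t (Sum.inl σ))) 0 :=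
    HasDerivAt.fun_sum (u := Finset.univ) fun σ _ => (hasDerivAt_pi.1 hμ σ).mul
      (hasDerivAt_pi.1 (S.hasDerivAt_variedVel hw ht) (Sum.inl σ))
  rw [h₁.unique (h₂.add h₃), S.fderiv_uncurryCost hC (z := S.costCurve (w 0) t) ht]
  unfold costTheta quasiVar
  rw [S.sum_thetaDeriv_mul ht]
  rfl

/-- Both integrations by parts in differential form. The inputs are `d/dt ∂C/∂a = ∂C/∂u - κ`, which
is the definition of `κ`, and the transpositional relation for `d(δθ)/dt`. -/
theorem hasDerivAt_boundaryTerm (hC : ContDiffOn ℝ ∞ (uncurryCost C) (S.U ×ˢ Set.univ))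
    (hw : ContDiff ℝ 4 (fun p : ℝ × ℝ => w p.1 p.2))
    (hν : ContDiff ℝ 1 (fun p : ℝ × ℝ => ν p.1 p.2)) {t : ℝ} (ht : w 0 t ∈ S.U) :
    HasDerivAt (S.boundaryTerm C w ν)
      (fderiv ℝ (S.variedIntegrand C w ν) (0, t) (1, 0) - S.reducedVariation C w ν t) t := by
  have hq := contDiff_slice hw 0
  have hμ : ContDiff ℝ 1 (ν 0) := hν.comp (contDiff_const.prodMk contDiff_id)
  have hJ : ∀ J, HasDerivAt (fun τ => costAcc C J (S.costCurve (w 0) τ))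
      (costVel C J (S.costCurve (w 0) t) - S.kappa C (w 0) t J) t := fun J => by
    rw [S.kappa_eq, sub_sub_cancel]
    exact (S.hasDerivAt_comp_costCurve (S.contDiffOn_costAcc hC J) hq ht).differentiableAt.hasDerivAt
  have hl : ∀ k, HasDerivAt (S.multiplier C (w 0) (ν 0) k)
      (deriv (S.multiplier C (w 0) (ν 0) k) t) t := fun k =>
    ((S.contDiffOn_multiplier hC hq hμ k).differentiableAt_of_mem (S.isOpen_preimage_U hq)
      (by norm_num) ht).hasDerivAt
  have hv := (S.hasDerivAt_varFreeVel hw ht).differentiableAt.hasDerivAt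
  have h : HasDerivAt (S.boundaryTerm C w ν)
      (∑ J, ((costVel C J (S.costCurve (w 0) t) - S.kappa C (w 0) t J) * S.varFreeVel w t J
          + costAcc C J (S.costCurve (w 0) t) * deriv (S.varFreeVel w) t J)
        + ∑ k, (deriv (S.multiplier C (w 0) (ν 0) k) t * S.quasiVar w t k
          + S.multiplier C (w 0) (ν 0) k t * (S.varVel w t k
            - ∑ l, S.hamelFull (w 0 t) (S.quasiVel (w 0) t) k l * S.quasiVar w t l))) t :=
    (HasDerivAt.fun_sum (u := Finset.univ) fun J _ => (hJ J).mul (hasDerivAt_pi.1 hv J)).add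
      (HasDerivAt.fun_sum (u := Finset.univ) fun k _ => (hl k).mul (S.hasDerivAt_quasiVar hw ht k))
  convert h using 1
  -- The `κ_J δu^J` split off here cancels the one coming from `hJ`; the constrained part matches
  -- `μ_σ δu^σ` in the varied integrand.
  have e₁ : ∑ k, S.multiplier C (w 0) (ν 0) k t * S.varVel w t k =
      ∑ σ, ν 0 t σ * S.varVel w t (Sum.inl σ) + ∑ J, S.kappa C (w 0) t J * S.varFreeVel w t J := by
    rw [Fintype.sum_sum_type]
    simp only [S.varFreeVel_apply hw ht]
    rfl
  have e₂ : ∑ k, (∑ s, S.multiplier C (w 0) (ν 0) s t *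
        S.hamelFull (w 0 t) (S.quasiVel (w 0) t) s k) * S.quasiVar w t k =
      ∑ k, S.multiplier C (w 0) (ν 0) k t *
        ∑ l, S.hamelFull (w 0 t) (S.quasiVel (w 0) t) k l * S.quasiVar w t l := by
    simp only [Finset.sum_mul, Finset.mul_sum]
    rw [Finset.sum_comm]
    exact Finset.sum_congr rfl fun k _ => Finset.sum_congr rfl fun l _ => by ring
  rw [S.fderiv_variedIntegrand hC hw hν ht]
  unfold reducedVariation eulerLagrange
  simp only [add_mul, sub_mul, mul_sub, Finset.sum_add_distrib, Finset.sum_sub_distrib, e₁, e₂]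
  ring

end Variation

end System

end BoltzmannHamel

/-! ### The fundamental lemma and the first variation formula. -/

namespace BoltzmannHamel

/-- A continuous function that is orthogonal to all test functions vanishes. -/
theorem eqOn_zero_of_integral_mul_eq_zero {f : ℝ → ℝ} {t₀ t₁ : ℝ} (h01 : t₀ < t₁)
    (hf : ContinuousOn f (Set.Icc t₀ t₁))
    (h : ∀ φ : ℝ → ℝ, ContDiff ℝ ∞ φ → tsupport φ ⊆ Set.Ioo t₀ t₁ →
      ∫ t in t₀..t₁, φ t * f t = 0) : Set.EqOn f 0 (Set.Icc t₀ t₁) := by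
  have hae := isOpen_Ioo.ae_eq_zero_of_integral_contDiff_smul_eq_zero
    (μ := MeasureTheory.volume) (f := f) (U := Set.Ioo t₀ t₁)
    ((hf.mono Set.Ioo_subset_Icc_self).locallyIntegrableOn measurableSet_Ioo)
    fun φ hφ _ hsupp => by
      rw [← h φ hφ hsupp, intervalIntegral.integral_eq_integral_of_support_subset]
      · simp
      · refine (Function.support_mul_subset_left φ f).trans ?_
        exact (subset_tsupport φ).trans (hsupp.trans Set.Ioo_subset_Ioc_self)
  -- Continuity upgrades almost everywhere vanishing on the open interval to vanishing on the closed
  -- one.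
  refine MeasureTheory.Measure.eqOn_Icc_of_ae_eq (μ := MeasureTheory.volume) h01.ne ?_ hf
    continuousOn_const
  rw [← MeasureTheory.restrict_Ioo_eq_restrict_Icc]
  exact (MeasureTheory.ae_restrict_iff' measurableSet_Ioo).2 hae

namespace System

variable {m r : ℕ} (S : System m r) {C : Conf m r → Free r → Free r → ℝ}
  {w : ℝ → ℝ → Conf m r} {ν : ℝ → ℝ → Mult m} {t₀ t₁ : ℝ}

theorem continuousOn_reducedVariation
    (hC : ContDiffOn ℝ ∞ (uncurryCost C) (S.U ×ˢ Set.univ))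
    (hw : ContDiff ℝ 4 (fun p : ℝ × ℝ => w p.1 p.2))
    (hν : ContDiff ℝ 1 (fun p : ℝ × ℝ => ν p.1 p.2)) :
    ContinuousOn (S.reducedVariation C w ν) (w 0 ⁻¹' S.U) := by
  have hq := contDiff_slice hw 0
  have hμ : ContDiff ℝ 1 (ν 0) := hν.comp (contDiff_const.prodMk contDiff_id)
  have hζ : ∀ k, ContinuousOn (fun t => S.quasiVar w t k) (w 0 ⁻¹' S.U) := fun k t ht =>
    (S.hasDerivAt_quasiVar hw ht k).continuousAt.continuousWithinAt
  have hm : Continuous (varMult ν) :=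
    ((hν.continuous_fderiv (by norm_num)).comp (by fun_prop : Continuous fun t : ℝ =>
      ((0 : ℝ), t))).clm_apply continuous_const
  refine (continuousOn_finsetSum _ fun k _ =>
    (S.continuousOn_eulerLagrange hC hq hμ k).mul (hζ k)).add
    (continuousOn_finsetSum _ fun σ _ => ContinuousOn.mul ?_ ?_)
  · exact ((continuous_apply σ).comp hm).continuousOn
  · exact continuousOn_pi.1 (S.contDiffOn_quasiVel hq).continuousOn (Sum.inl σ)

/-- Fixing the position kills `δq`, hence `δθ`. Since `u` depends on `q` and `dq/dt`, fixing the
velocity as well kills `δu`. -/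
theorem boundaryTerm_eq_zero (hw : ContDiff ℝ 4 (fun p : ℝ × ℝ => w p.1 p.2)) {t : ℝ}
    (ht : w 0 t ∈ S.U) (hfix : ∀ s, w s t = w 0 t) (hvel : ∀ s, deriv (w s) t = deriv (w 0) t) :
    S.boundaryTerm C w ν t = 0 := by
  have h₁ : varCoord w t = 0 := by
    refine (hasDerivAt_varied hw t).unique ?_
    simp only [hfix]
    exact hasDerivAt_const _ _
  have h₂ : S.varFreeVel w t = 0 := by
    refine (S.hasDerivAt_variedFreeVel hw ht).unique ?_
    have : (fun s => S.freeVel (w s) t) = fun _ => S.freeVel (w 0) t := by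
      funext s A
      simp only [freeVel, quasiVel, hfix s, hvel s]
    rw [this]
    exact hasDerivAt_const _ _
  simp [boundaryTerm, quasiVar, h₁, h₂]

/-- Differentiation under the integral sign, followed by the fundamental theorem of calculus for
`boundaryTerm`, which is zero at both ends. -/
theorem hasDerivAt_augmentedCost (hC : ContDiffOn ℝ ∞ (uncurryCost C) (S.U ×ˢ Set.univ))
    (h01 : t₀ < t₁) (hw : S.IsProperVariation t₀ t₁ (w 0) w)
    (hν : ContDiff ℝ 1 (fun p : ℝ × ℝ => ν p.1 p.2)) :
    HasDerivAt (fun s => S.augmentedCost C t₀ t₁ (w s) (ν s))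
      (∫ t in t₀..t₁, S.reducedVariation C w ν t) 0 := by
  obtain ⟨ε, hε, hmem⟩ := hw.mem
  have hq : ∀ t ∈ Set.Icc t₀ t₁, w 0 t ∈ S.U := hmem 0 ⟨by linarith, hε.le⟩
  have hF := S.contDiffOn_variedIntegrand hC hw.contDiff hν
  have hW := S.isOpen_variationDomain hw.contDiff
  have h := hasDerivAt_integral_of_contDiffOn hW hF h01.le hε hmem
  have hc₁ : ContinuousOn (fun t => fderiv ℝ (S.variedIntegrand C w ν) (0, t) (1, 0))
      (Set.Icc t₀ t₁) :=
    ContinuousOn.comp (g := fun p => fderiv ℝ (S.variedIntegrand C w ν) p (1, 0))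
      ((hF.continuousOn_fderiv_of_isOpen hW le_rfl).clm_apply continuousOn_const)
      (by fun_prop) hq
  have hc₂ : ContinuousOn (S.reducedVariation C w ν) (Set.Icc t₀ t₁) :=
    (S.continuousOn_reducedVariation hC hw.contDiff hν).mono hq
  rw [← Set.uIcc_of_le h01.le] at hc₁ hc₂
  have hB := intervalIntegral.integral_eq_sub_of_hasDerivAt
    (fun t ht => S.hasDerivAt_boundaryTerm hC hw.contDiff hν
      (hq t (by rwa [Set.uIcc_of_le h01.le] at ht))) (hc₁.sub hc₂).intervalIntegrable
  rw [S.boundaryTerm_eq_zero hw.contDiff (hq t₁ ⟨h01.le, le_rfl⟩) hw.right hw.right_vel,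
    S.boundaryTerm_eq_zero hw.contDiff (hq t₀ ⟨le_rfl, h01.le⟩) hw.left hw.left_vel,
    intervalIntegral.integral_sub hc₁.intervalIntegrable hc₂.intervalIntegrable, sub_zero,
    sub_eq_zero] at hB
  rw [← hB]
  exact h

/-! ### Extremals -/

variable {q : ℝ → Conf m r} {μ : ℝ → Mult m}

/-- The bump `φ` vanishes near both end points, so positions and velocities there are unchanged. The
tube lemma keeps the whole curve in the open set `U` for small parameters. -/
theorem isProperVariation_add_smul (hq : ContDiff ℝ 4 q) (hU : ∀ t ∈ Set.Icc t₀ t₁, q t ∈ S.U)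
    {φ : ℝ → ℝ} (hφ : ContDiff ℝ ∞ φ) (hsupp : tsupport φ ⊆ Set.Ioo t₀ t₁) (η : Conf m r) :
    S.IsProperVariation t₀ t₁ q (fun s t => q t + (s * φ t) • η) := by
  have hcd : ContDiff ℝ 4 (fun p : ℝ × ℝ => q p.2 + (p.1 * φ p.2) • η) :=
    (hq.comp contDiff_snd).add ((contDiff_fst.mul
      ((hφ.of_le ENat.LEInfty.out).comp contDiff_snd)).smul contDiff_const)
  have hzero : ∀ t, t ∉ Set.Ioo t₀ t₁ → φ =ᶠ[nhds t] 0 := fun t ht =>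
    notMem_tsupport_iff_eventuallyEq.1 fun h => ht (hsupp h)
  have hev : ∀ t, t ∉ Set.Ioo t₀ t₁ → ∀ s, (fun t => q t + (s * φ t) • η) =ᶠ[nhds t] q :=
    fun t ht s => by
      filter_upwards [hzero t ht] with τ hτ
      simp [hτ]
  refine ⟨hcd, fun t => by simp, fun s => (hev t₀ (by simp) s).self_of_nhds,
    fun s => (hev t₁ (by simp) s).self_of_nhds, fun s => (hev t₀ (by simp) s).deriv_eq,
    fun s => (hev t₁ (by simp) s).deriv_eq, ?_⟩
  obtain ⟨u, v, hu, -, h0u, hv, huv⟩ := generalized_tube_lemma (isCompact_singleton (x := (0 : ℝ)))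
    (isCompact_Icc (a := t₀) (b := t₁)) (S.isOpen_U.preimage hcd.continuous)
    (by
      rintro ⟨s, t⟩ ⟨hs, ht⟩
      obtain rfl : s = 0 := hs
      simpa using hU t ht)
  obtain ⟨ε, hε, hball⟩ := Metric.isOpen_iff.1 hu 0 (h0u rfl)
  refine ⟨ε / 2, by positivity, fun s hs t ht => huv (a := (s, t)) ⟨hball ?_, hv ht⟩⟩
  rw [Metric.mem_ball, dist_zero_right, Real.norm_eq_abs]
  exact (abs_le.2 hs).trans_lt (by linarith)

theorem isExtremal_iff (hC : ContDiffOn ℝ ∞ (uncurryCost C) (S.U ×ˢ Set.univ)) (h01 : t₀ < t₁)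
    (hq : ContDiff ℝ 4 q) (hμ : ContDiff ℝ 1 μ) (hU : ∀ t ∈ Set.Icc t₀ t₁, q t ∈ S.U) :
    S.IsExtremal C t₀ t₁ q μ ↔ ∀ t ∈ Set.Icc t₀ t₁, S.OptimalBH C q μ t := by
  constructor
  · intro h
    -- Variations in constant directions `η` and `β`, scaled by a bump `φ`, make the first variation
    -- `∫ φ · (this expression)`, so the fundamental lemma applies.
    have key : ∀ (η : Conf m r) (β : Mult m), ∀ t ∈ Set.Icc t₀ t₁,
        ∑ k, S.eulerLagrange C q μ t k * (S.Psi (q t) *ᵥ η) k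
          + ∑ σ, β σ * S.quasiVel q t (Sum.inl σ) = 0 := by
      intro η β
      refine eqOn_zero_of_integral_mul_eq_zero h01 (ContinuousOn.mono ?_ hU) fun φ hφ hsupp => ?_
      · refine (continuousOn_finsetSum _ fun k _ =>
          (S.continuousOn_eulerLagrange hC hq hμ k).mul ?_).add
          (continuousOn_finsetSum _ fun σ _ => continuousOn_const.mul
            (continuousOn_pi.1 (S.contDiffOn_quasiVel hq).continuousOn (Sum.inl σ)))
        exact continuousOn_pi.1 (contDiffOn_mulVec (k := 4) (fun i j =>
          S.contDiffOn_comp_curve (S.contDiffOn_Psi i j) hq le_rfl)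
          contDiffOn_const).continuousOn k
      · have hw := S.isProperVariation_add_smul hq hU hφ hsupp η
        have hν : ContDiff ℝ 1 (fun p : ℝ × ℝ => μ p.2 + (p.1 * φ p.2) • β) :=
          (hμ.comp contDiff_snd).add ((contDiff_fst.mul
            ((hφ.of_le ENat.LEInfty.out).comp contDiff_snd)).smul contDiff_const)
        have h₁ := h _ (fun s t => μ t + (s * φ t) • β) hw hν fun t => by simp
        have hw0 : (fun t => q t + ((0 : ℝ) * φ t) • η) = q := by simp
        have hν0 : (fun t => μ t + ((0 : ℝ) * φ t) • β) = μ := by simp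
        have h₂ := S.hasDerivAt_augmentedCost (w := fun s t => q t + (s * φ t) • η)
          (ν := fun s t => μ t + (s * φ t) • β) hC h01 (by simpa only [hw0] using hw) hν
        rw [← h₂.unique h₁]
        refine intervalIntegral.integral_congr fun t _ => ?_
        have hlin : ∀ {F : Type} [NormedAddCommGroup F] [NormedSpace ℝ F] (x v : F),
            HasDerivAt (fun s : ℝ => x + (s * φ t) • v) (φ t • v) 0 := fun x v => by
          have := (((hasDerivAt_id (0 : ℝ)).mul_const (φ t)).smul_const v).const_add x
          simpa using this
        have e₁ : varCoord (fun s t => q t + (s * φ t) • η) t = φ t • η :=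
          (hasDerivAt_varied hw.contDiff t).unique (hlin (q t) η)
        have e₂ : varMult (fun s t => μ t + (s * φ t) • β) t = φ t • β :=
          (hasDerivAt_slice_fst (hν.differentiable (by norm_num) (0, t))).unique (hlin (μ t) β)
        simp only [reducedVariation, quasiVar, e₁, e₂, zero_mul, zero_smul, add_zero,
          Matrix.mulVec_smul, Pi.smul_apply, smul_eq_mul, mul_add, Finset.mul_sum]
        congr 1 <;> exact Finset.sum_congr rfl fun _ _ => by ring
    intro t ht
    refine (S.optimalBH_iff (hU t ht)).2 ⟨fun σ => ?_, fun k => ?_⟩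
    · simpa [Pi.single_apply] using key 0 (Pi.single σ 1) t ht
    -- Since `key` holds for every constant `η`, the vector may be chosen after `t`: this one has
    -- quasi-components `e_k` at `q t`.
    · have := key (S.Phi (q t) *ᵥ Pi.single k 1) 0 t ht
      rw [Matrix.mulVec_mulVec, S.Psi_mul_Phi (hU t ht), Matrix.one_mulVec] at this
      simpa [Pi.single_apply] using this
  · intro h w ν hw hν hν0
    have hw0 : w 0 = q := funext hw.base
    have hν0' : ν 0 = μ := funext hν0
    subst hw0 hν0'
    convert S.hasDerivAt_augmentedCost hC h01 hw hν using 1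
    rw [eq_comm, ← intervalIntegral.integral_zero (a := t₀) (b := t₁)]
    refine intervalIntegral.integral_congr fun t ht => ?_
    rw [Set.uIcc_of_le h01.le] at ht
    obtain ⟨h₁, h₂⟩ := (S.optimalBH_iff (hU t ht)).1 (h t ht)
    simp [reducedVariation, h₁, h₂]

end System

end BoltzmannHamel

namespace BoltzmannHamel

namespace System

variable {m r : ℕ} (S : System m r) {C : Conf m r → Free r → Free r → ℝ}

/-! ### The first-order system -/

/-- `κ_J` as a function of `q`, `u`, `a` and the quasi-jerks. -/
noncomputable def kappaState (C : Conf m r → Free r → Free r → ℝ) (J : Fin r)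
    (y : Conf m r × Free r × Free r × Free r) : ℝ :=
  costVel C J (y.1, y.2.1, y.2.2.1) - fderiv ℝ (costAcc C J) (y.1, y.2.1, y.2.2.1)
    (S.Phi y.1 *ᵥ embed y.2.1, y.2.2.1, y.2.2.2)

theorem contDiffOn_kappaState (hC : ContDiffOn ℝ ∞ (uncurryCost C) (S.U ×ˢ Set.univ))
    (J : Fin r) : ContDiffOn ℝ ∞ (S.kappaState C J) (S.U ×ˢ Set.univ) := by
  have hp : ContDiffOn ℝ ∞ (fun y : Conf m r × Free r × Free r × Free r =>
      (y.1, y.2.1, y.2.2.1)) (S.U ×ˢ Set.univ) :=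
    (contDiff_fst.prodMk ((contDiff_fst.comp contDiff_snd).prodMk
      (contDiff_fst.comp (contDiff_snd.comp contDiff_snd)))).contDiffOn
  have hmaps : Set.MapsTo (fun y : Conf m r × Free r × Free r × Free r =>
      (y.1, y.2.1, y.2.2.1)) (S.U ×ˢ Set.univ) (S.U ×ˢ Set.univ) := fun y hy => ⟨hy.1, trivial⟩
  have h₁ := (S.contDiffOn_costVel hC J).comp hp hmaps
  have h₂ := ((S.contDiffOn_costAcc hC J).fderiv_of_isOpen S.isOpen_domain
    (m := ∞) (by simp)).comp hp hmaps
  have h₃ : ContDiffOn ℝ ∞ (fun y : Conf m r × Free r × Free r × Free r =>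
      (S.Phi y.1 *ᵥ embed y.2.1, y.2.2.1, y.2.2.2)) (S.U ×ˢ Set.univ) :=
    (S.contDiffOn_Phi_mulVec (contDiff_embed.comp contDiff_fst)).prodMk
      (contDiff_snd.comp contDiff_snd).contDiffOn
  have h₄ := h₂.clm_apply h₃
  exact h₁.sub h₄

/-- `costAcc C A` is itself treated as a cost integrand: its partial derivatives in `a` form row `A`
of the Hessian, so no symmetry is needed. -/
theorem fderiv_costAcc_acc (hC : ContDiffOn ℝ ∞ (uncurryCost C) (S.U ×ˢ Set.univ)) (A : Fin r)
    {z : Conf m r × Free r × Free r} (hz : z.1 ∈ S.U) (v : Free r) :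
    fderiv ℝ (costAcc C A) z (0, 0, v) = (accHessian C z.1 z.2.1 z.2.2 *ᵥ v) A := by
  have h := S.fderiv_uncurryCost (C := fun q u a => costAcc C A (q, u, a))
    (S.contDiffOn_costAcc hC A) hz (0, 0, v)
  simp only [Pi.zero_apply, mul_zero, Finset.sum_const_zero, zero_add] at h
  exact h

theorem contDiffOn_accHessian (hC : ContDiffOn ℝ ∞ (uncurryCost C) (S.U ×ˢ Set.univ))
    (A B : Fin r) :
    ContDiffOn ℝ ∞ (fun z : Conf m r × Free r × Free r => accHessian C z.1 z.2.1 z.2.2 A B)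
      (S.U ×ˢ Set.univ) :=
  S.contDiffOn_costAcc (C := fun q u a => costAcc C A (q, u, a)) (S.contDiffOn_costAcc hC A) B

/-- The jerk enters `κ` only through the linear argument of the derivative of `∂C/∂a`, so `κ` is
affine in it with linear part minus the Hessian. -/
theorem fderiv_kappaState (hC : ContDiffOn ℝ ∞ (uncurryCost C) (S.U ×ˢ Set.univ)) (A : Fin r)
    {y : Conf m r × Free r × Free r × Free r} (hy : y.1 ∈ S.U) (x : Conf m r) (b c v : Free r) :
    fderiv ℝ (S.kappaState C A) y (x, b, c, v) = fderiv ℝ (S.kappaState C A) y (x, b, c, 0)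
      - (accHessian C y.1 y.2.1 y.2.2.1 *ᵥ v) A := by
  have hsplit : ((x, b, c, v) : Conf m r × Free r × Free r × Free r)
      = (x, b, c, 0) + (0, 0, 0, v) := by simp
  rw [hsplit, map_add, sub_eq_add_neg]
  congr 1
  have hline : HasDerivAt (fun σ : ℝ => ((y.1, y.2.1, y.2.2.1, y.2.2.2 + σ • v) :
      Conf m r × Free r × Free r × Free r)) (0, 0, 0, v) 0 := by
    refine (hasDerivAt_const _ _).prodMk ((hasDerivAt_const _ _).prodMk
      ((hasDerivAt_const _ _).prodMk ?_))
    simpa using ((hasDerivAt_id (0 : ℝ)).smul_const v).const_add y.2.2.2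
  have hd : DifferentiableAt ℝ (S.kappaState C A) (y.1, y.2.1, y.2.2.1, y.2.2.2 + (0 : ℝ) • v) := by
    simpa using (S.contDiffOn_kappaState hC A).differentiableAt_of_mem S.isOpen_domain (by simp)
      (x := y) ⟨hy, trivial⟩
  have h₁ := hd.hasFDerivAt.comp_hasDerivAt (0 : ℝ) hline
  have hline' : HasDerivAt (fun σ : ℝ => ((S.Phi y.1 *ᵥ embed y.2.1, y.2.2.1, y.2.2.2 + σ • v) :
      Conf m r × Free r × Free r)) (0, 0, v) 0 := by
    refine (hasDerivAt_const _ _).prodMk ((hasDerivAt_const _ _).prodMk ?_)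
    simpa using ((hasDerivAt_id (0 : ℝ)).smul_const v).const_add y.2.2.2
  have h₂ := ((fderiv ℝ (costAcc C A) (y.1, y.2.1, y.2.2.1)).hasFDerivAt.comp_hasDerivAt (0 : ℝ)
    hline').const_sub (costVel C A (y.1, y.2.1, y.2.2.1))
  have h₃ := h₁.unique h₂
  rw [S.fderiv_costAcc_acc hC A (z := (y.1, y.2.1, y.2.2.1)) hy] at h₃
  simpa using h₃

/-- The terms of the unconstrained equations that do not contain the derivative of the
quasi-jerks. -/
noncomputable def jerkForce (C : Conf m r → Free r → Free r → ℝ) (z : State m r) : Free r :=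
  fun A => - S.thetaDeriv (fun x => C x z.2.1 z.2.2.1) z.1 (Sum.inr A)
    + fderiv ℝ (S.kappaState C A) (z.1, z.2.1, z.2.2.1, z.2.2.2.1)
        (S.Phi z.1 *ᵥ embed z.2.1, z.2.2.1, z.2.2.2.1, 0)
    - ∑ J, S.kappaState C J (z.1, z.2.1, z.2.2.1, z.2.2.2.1)
        * S.hamelContr z.1 z.2.1 (Sum.inr J) (Sum.inr A)
    - ∑ τ, z.2.2.2.2 τ * S.hamelContr z.1 z.2.1 (Sum.inl τ) (Sum.inr A)

/-- The derivative of the quasi-jerks as a function of the state. -/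
noncomputable def jerkRate (C : Conf m r → Free r → Free r → ℝ) (z : State m r) : Free r :=
  (accHessian C z.1 z.2.1 z.2.2.1)⁻¹ *ᵥ S.jerkForce C z

/-- The derivative of the multipliers as a function of the state. -/
noncomputable def multRate (C : Conf m r → Free r → Free r → ℝ) (z : State m r) : Mult m :=
  fun σ => S.thetaDeriv (fun x => C x z.2.1 z.2.2.1) z.1 (Sum.inl σ)
    + ∑ J, S.kappaState C J (z.1, z.2.1, z.2.2.1, z.2.2.2.1)
        * S.hamelContr z.1 z.2.1 (Sum.inr J) (Sum.inl σ)
    + ∑ τ, z.2.2.2.2 τ * S.hamelContr z.1 z.2.1 (Sum.inl τ) (Sum.inl σ)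

theorem regularStates_subset : S.regularStates C ⊆ S.U ×ˢ Set.univ := fun _ hz => ⟨hz.1, trivial⟩

theorem contDiff_state_cost : ContDiff ℝ ∞ (fun z : State m r => (z.1, z.2.1, z.2.2.1)) :=
  contDiff_fst.prodMk ((contDiff_fst.comp contDiff_snd).prodMk
    (contDiff_fst.comp (contDiff_snd.comp contDiff_snd)))

theorem contDiff_state_jet :
    ContDiff ℝ ∞ (fun z : State m r => (z.1, z.2.1, z.2.2.1, z.2.2.2.1)) :=
  contDiff_fst.prodMk ((contDiff_fst.comp contDiff_snd).prodMk
    ((contDiff_fst.comp (contDiff_snd.comp contDiff_snd)).prodMk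
      (contDiff_fst.comp (contDiff_snd.comp (contDiff_snd.comp contDiff_snd)))))

theorem isOpen_regularStates (hC : ContDiffOn ℝ ∞ (uncurryCost C) (S.U ×ˢ Set.univ)) :
    IsOpen (S.regularStates C) := by
  have h : ContinuousOn (fun z : State m r => (accHessian C z.1 z.2.1 z.2.2.1).det)
      (S.U ×ˢ Set.univ) :=
    (contDiffOn_det (k := ∞) fun A B => (S.contDiffOn_accHessian hC A B).comp
      contDiff_state_cost.contDiffOn fun _ hz => ⟨hz.1, trivial⟩).continuousOn
  have h₂ := h.isOpen_inter_preimage S.isOpen_domain (isOpen_compl_singleton (x := (0 : ℝ)))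
  convert h₂ using 1
  ext z
  exact ⟨fun hz => ⟨⟨hz.1, trivial⟩, hz.2⟩, fun hz => ⟨hz.1.1, hz.2⟩⟩

theorem contDiffOn_state_kappa (hC : ContDiffOn ℝ ∞ (uncurryCost C) (S.U ×ˢ Set.univ))
    (J : Fin r) : ContDiffOn ℝ ∞
      (fun z : State m r => S.kappaState C J (z.1, z.2.1, z.2.2.1, z.2.2.2.1))
      (S.U ×ˢ Set.univ) :=
  (S.contDiffOn_kappaState hC J).comp contDiff_state_jet.contDiffOn fun _ hz => ⟨hz.1, trivial⟩

theorem contDiffOn_state_thetaDeriv (hC : ContDiffOn ℝ ∞ (uncurryCost C) (S.U ×ˢ Set.univ))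
    (k : Idx m r) : ContDiffOn ℝ ∞
      (fun z : State m r => S.thetaDeriv (fun x => C x z.2.1 z.2.2.1) z.1 k)
      (S.U ×ˢ Set.univ) :=
  (S.contDiffOn_thetaDeriv hC k).comp contDiff_state_cost.contDiffOn fun _ hz => ⟨hz.1, trivial⟩

theorem contDiffOn_state_mult (s k : Idx m r) (τ : Fin m) : ContDiffOn ℝ ∞
    (fun z : State m r => z.2.2.2.2 τ * S.hamelContr z.1 z.2.1 s k) (S.U ×ˢ Set.univ) :=
  ((contDiff_apply ℝ ℝ τ).comp (contDiff_snd.comp (contDiff_snd.comp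
    (contDiff_snd.comp contDiff_snd)))).contDiffOn.mul
    (S.contDiffOn_hamelContr contDiff_fst s k)

theorem contDiffOn_multRate (hC : ContDiffOn ℝ ∞ (uncurryCost C) (S.U ×ˢ Set.univ)) :
    ContDiffOn ℝ ∞ (S.multRate C) (S.U ×ˢ Set.univ) := by
  rw [contDiffOn_pi]
  intro σ
  exact ((S.contDiffOn_state_thetaDeriv hC _).add (ContDiffOn.sum fun J _ =>
    (S.contDiffOn_state_kappa hC J).mul (S.contDiffOn_hamelContr contDiff_fst _ _))).add
    (ContDiffOn.sum fun τ _ => S.contDiffOn_state_mult _ _ τ)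

theorem contDiffOn_jerkForce (hC : ContDiffOn ℝ ∞ (uncurryCost C) (S.U ×ˢ Set.univ)) :
    ContDiffOn ℝ ∞ (S.jerkForce C) (S.U ×ˢ Set.univ) := by
  rw [contDiffOn_pi]
  intro A
  have h₁ := ((S.contDiffOn_kappaState hC A).fderiv_of_isOpen S.isOpen_domain
    (m := ∞) (by simp)).comp (contDiff_state_jet (m := m) (r := r)).contDiffOn
    (s := S.U ×ˢ Set.univ) fun z hz => ⟨hz.1, trivial⟩
  have h₂ : ContDiffOn ℝ ∞ (fun z : State m r =>
      ((S.Phi z.1 *ᵥ embed z.2.1, z.2.2.1, z.2.2.2.1, 0) :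
        Conf m r × Free r × Free r × Free r)) (S.U ×ˢ Set.univ) :=
    (S.contDiffOn_Phi_mulVec (contDiff_embed.comp contDiff_fst)).prodMk
      ((contDiff_fst.comp (contDiff_snd.comp contDiff_snd)).prodMk
        ((contDiff_fst.comp (contDiff_snd.comp (contDiff_snd.comp contDiff_snd))).prodMk
          contDiff_const)).contDiffOn
  have h₃ := h₁.clm_apply h₂
  have h₄ := (S.contDiffOn_state_thetaDeriv hC (Sum.inr A)).neg.add h₃
  exact (h₄.sub (ContDiffOn.sum fun J _ =>
    (S.contDiffOn_state_kappa hC J).mul (S.contDiffOn_hamelContr contDiff_fst _ _))).sub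
    (ContDiffOn.sum fun τ _ => S.contDiffOn_state_mult _ _ τ)

theorem contDiffOn_jerkRate (hC : ContDiffOn ℝ ∞ (uncurryCost C) (S.U ×ˢ Set.univ)) :
    ContDiffOn ℝ ∞ (S.jerkRate C) (S.regularStates C) :=
  contDiffOn_mulVec (fun A B => contDiffOn_inv_apply (fun A B =>
    (S.contDiffOn_accHessian hC A B).comp contDiff_state_cost.contDiffOn
      fun _ hz => ⟨hz.1, trivial⟩) (fun _ hz => hz.2) A B)
    ((S.contDiffOn_jerkForce hC).mono S.regularStates_subset)

theorem contDiffOn_firstOrderField (hC : ContDiffOn ℝ ∞ (uncurryCost C) (S.U ×ˢ Set.univ)) :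
    ContDiffOn ℝ ∞ (S.firstOrderField (S.jerkRate C) (S.multRate C)) (S.regularStates C) :=
  ((S.contDiffOn_Phi_mulVec (contDiff_embed.comp contDiff_fst)).mono
    S.regularStates_subset).prodMk
    ((contDiff_fst.comp (contDiff_snd.comp contDiff_snd)).contDiffOn.prodMk
      ((contDiff_fst.comp (contDiff_snd.comp (contDiff_snd.comp contDiff_snd))).contDiffOn.prodMk
        ((S.contDiffOn_jerkRate hC).prodMk
          ((S.contDiffOn_multRate hC).mono S.regularStates_subset))))

/-! ### Equivalence with the first-order system along curves. -/

section Curve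

variable {q : ℝ → Conf m r} {μ : ℝ → Mult m} {t₀ t₁ : ℝ}

/-- The arguments `(q, u, a)` and the quasi-jerks along a curve. -/
noncomputable def jetCurve (q : ℝ → Conf m r) (t : ℝ) : Conf m r × Free r × Free r × Free r :=
  (q t, S.freeVel q t, S.freeAcc q t, S.freeJerk q t)

theorem kappa_eq_kappaState (hC : ContDiffOn ℝ ∞ (uncurryCost C) (S.U ×ˢ Set.univ))
    (hq : ContDiff ℝ 4 q) {t : ℝ} (ht : q t ∈ S.U) (hk : S.Kinematic q t) (J : Fin r) :
    S.kappa C q t J = S.kappaState C J (S.jetCurve q t) := by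
  have h := S.hasDerivAt_comp_costCurve (S.contDiffOn_costAcc hC J) hq ht
  rw [hk] at h
  rw [kappa_eq, h.deriv]
  rfl

/-- The kinematic relation, and with it `κ = kappaState`, is known only on `[t₀, t₁]`. Derivatives
within that interval are therefore compared; they are unique even at its end points because `t₀ <
t₁`. -/
theorem deriv_kappa (hC : ContDiffOn ℝ ∞ (uncurryCost C) (S.U ×ˢ Set.univ)) (h01 : t₀ < t₁)
    (hq : ContDiff ℝ 4 q) (hU : ∀ t ∈ Set.Icc t₀ t₁, q t ∈ S.U)
    (hk : ∀ t ∈ Set.Icc t₀ t₁, S.Kinematic q t) {t : ℝ} (ht : t ∈ Set.Icc t₀ t₁) (A : Fin r) :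
    deriv (fun τ => S.kappa C q τ A) t =
      fderiv ℝ (S.kappaState C A) (S.jetCurve q t)
        (S.Phi (q t) *ᵥ embed (S.freeVel q t), S.freeAcc q t, S.freeJerk q t, 0)
      - (accHessian C (q t) (S.freeVel q t) (S.freeAcc q t) *ᵥ deriv (S.freeJerk q) t) A := by
  have h₁ : HasDerivWithinAt (fun τ => S.kappa C q τ A) (deriv (fun τ => S.kappa C q τ A) t)
      (Set.Icc t₀ t₁) t :=
    ((S.contDiffOn_kappa hC hq A).differentiableAt_of_mem (S.isOpen_preimage_U hq) (by norm_num)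
      (hU t ht)).hasDerivAt.hasDerivWithinAt
  have hjet : HasDerivAt (S.jetCurve q)
      (deriv q t, S.freeAcc q t, S.freeJerk q t, deriv (S.freeJerk q) t) t :=
    (hasDerivAt_curve hq t).prodMk ((S.hasDerivAt_freeVel hq (hU t ht)).prodMk
      ((S.hasDerivAt_freeAcc hq (hU t ht)).prodMk (S.hasDerivAt_freeJerk hq (hU t ht))))
  have h₂ := (((S.contDiffOn_kappaState hC A).differentiableAt_of_mem S.isOpen_domain (by simp)
    (x := S.jetCurve q t) ⟨hU t ht, trivial⟩).hasFDerivAt.comp_hasDerivAt t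
    hjet).hasDerivWithinAt (s := Set.Icc t₀ t₁)
  have h₃ := h₂.congr (fun τ hτ => S.kappa_eq_kappaState hC hq (hU τ hτ) (hk τ hτ) A)
    (S.kappa_eq_kappaState hC hq (hU t ht) (hk t ht) A)
  rw [(uniqueDiffOn_Icc h01 t ht).eq_deriv _ h₁ h₃, S.fderiv_kappaState hC A (hU t ht), hk t ht]
  rfl

/-- The unconstrained equations read `Hessian · d(jerk)/dt = jerkForce`, solvable at regular states,
and the constrained ones are already explicit in `dμ/dt`. -/
theorem optimalBH_iff_rates (hC : ContDiffOn ℝ ∞ (uncurryCost C) (S.U ×ˢ Set.univ))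
    (h01 : t₀ < t₁) (hq : ContDiff ℝ 4 q) (hμ : ContDiff ℝ 1 μ)
    (hreg : ∀ t ∈ Set.Icc t₀ t₁, S.stateOf q μ t ∈ S.regularStates C)
    (hk : ∀ t ∈ Set.Icc t₀ t₁, S.Kinematic q t) {t : ℝ} (ht : t ∈ Set.Icc t₀ t₁) :
    S.OptimalBH C q μ t ↔ deriv (S.freeJerk q) t = S.jerkRate C (S.stateOf q μ t) ∧
      deriv μ t = S.multRate C (S.stateOf q μ t) := by
  have hU : ∀ t ∈ Set.Icc t₀ t₁, q t ∈ S.U := fun t ht => (hreg t ht).1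
  have hκ := fun J => S.kappa_eq_kappaState hC hq (hU t ht) (hk t ht) J
  have hκ' := fun A => S.deriv_kappa hC h01 hq hU hk ht A
  have hμ' : ∀ σ, deriv (fun τ => μ τ σ) t = deriv μ t σ := fun σ =>
    (hasDerivAt_pi.1 (hμ.differentiable (by norm_num) t).hasDerivAt σ).deriv
  have hdet : IsUnit (accHessian C (q t) (S.freeVel q t) (S.freeAcc q t)).det :=
    isUnit_iff_ne_zero.2 (hreg t ht).2
  have hJ : deriv (S.freeJerk q) t = S.jerkRate C (S.stateOf q μ t) ↔
      accHessian C (q t) (S.freeVel q t) (S.freeAcc q t) *ᵥ deriv (S.freeJerk q) t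
        = S.jerkForce C (S.stateOf q μ t) := by
    unfold jerkRate stateOf
    constructor
    · intro h
      rw [h, Matrix.mulVec_mulVec, Matrix.mul_nonsing_inv _ hdet, Matrix.one_mulVec]
    · intro h
      rw [← h, Matrix.mulVec_mulVec, Matrix.nonsing_inv_mul _ hdet, Matrix.one_mulVec]
  rw [hJ, funext_iff, funext_iff]
  constructor
  · rintro ⟨h₁, h₂, -⟩
    refine ⟨fun A => ?_, fun σ => ?_⟩
    · have := h₁ A
      simp only [hκ, hκ'] at this
      simp only [jerkForce, stateOf]
      simp only [costTheta, jetCurve] at this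
      linarith
    · have := h₂ σ
      simp only [hκ, hμ'] at this
      simp only [multRate, stateOf]
      simp only [costTheta, jetCurve] at this
      linarith
  · rintro ⟨h₁, h₂⟩
    refine ⟨fun A => ?_, fun σ => ?_, hk t ht⟩
    · have := h₁ A
      simp only [hκ, hκ']
      simp only [jerkForce, stateOf] at this
      simp only [costTheta, jetCurve]
      linarith
    · have := h₂ σ
      simp only [hκ, hμ']
      simp only [multRate, stateOf] at this
      simp only [costTheta, jetCurve]
      linarith

theorem hasDerivAt_stateOf (hq : ContDiff ℝ 4 q) (hμ : ContDiff ℝ 1 μ) {t : ℝ} (ht : q t ∈ S.U) :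
    HasDerivAt (S.stateOf q μ)
      (deriv q t, S.freeAcc q t, S.freeJerk q t, deriv (S.freeJerk q) t, deriv μ t) t :=
  (hasDerivAt_curve hq t).prodMk ((S.hasDerivAt_freeVel hq ht).prodMk
    ((S.hasDerivAt_freeAcc hq ht).prodMk ((S.hasDerivAt_freeJerk hq ht).prodMk
      (hμ.differentiable (by norm_num) t).hasDerivAt)))

theorem hasDerivWithinAt_stateOf (hC : ContDiffOn ℝ ∞ (uncurryCost C) (S.U ×ˢ Set.univ))
    (h01 : t₀ < t₁) (hq : ContDiff ℝ 4 q) (hμ : ContDiff ℝ 1 μ)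
    (h : ∀ t ∈ Set.Icc t₀ t₁, S.stateOf q μ t ∈ S.regularStates C ∧ S.OptimalBH C q μ t)
    {t : ℝ} (ht : t ∈ Set.Icc t₀ t₁) :
    HasDerivWithinAt (S.stateOf q μ)
      (S.firstOrderField (S.jerkRate C) (S.multRate C) (S.stateOf q μ t)) (Set.Icc t₀ t₁) t := by
  have hd := S.hasDerivAt_stateOf hq hμ (h t ht).1.1
  obtain ⟨h₁, h₂⟩ := (S.optimalBH_iff_rates hC h01 hq hμ (fun t ht => (h t ht).1)
    (fun t ht => (h t ht).2.kinematic) ht).1 (h t ht).2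
  rw [h₁, h₂, (h t ht).2.kinematic] at hd
  exact hd.hasDerivWithinAt

theorem eqOn_deriv_of_hasDerivWithinAt {F : Type*} [NormedAddCommGroup F] [NormedSpace ℝ F]
    {f g g' : ℝ → F} (h01 : t₀ < t₁) (hfg : Set.EqOn f g (Set.Icc t₀ t₁))
    (hg : ∀ t ∈ Set.Icc t₀ t₁, HasDerivWithinAt g (g' t) (Set.Icc t₀ t₁) t)
    (hf : ∀ t ∈ Set.Icc t₀ t₁, DifferentiableAt ℝ f t) :
    Set.EqOn (deriv f) g' (Set.Icc t₀ t₁) := fun t ht =>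
  (uniqueDiffOn_Icc h01 t ht).eq_deriv _ (hf t ht).hasDerivAt.hasDerivWithinAt
    ((hg t ht).congr hfg (hfg ht))

/-- The first-order system is equivalent to the Boltzmann-Hamel equations for optimal dynamic
control. -/
theorem hasDerivWithinAt_firstOrderField_iff
    (hC : ContDiffOn ℝ ∞ (uncurryCost C) (S.U ×ˢ Set.univ)) (h01 : t₀ < t₁)
    {z : ℝ → State m r} (hq : ContDiff ℝ 4 (fun t => (z t).1))
    (hμ : ContDiff ℝ 1 (fun t => (z t).2.2.2.2))
    (hreg : ∀ t ∈ Set.Icc t₀ t₁, z t ∈ S.regularStates C) :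
    (∀ t ∈ Set.Icc t₀ t₁, HasDerivWithinAt z
        (S.firstOrderField (S.jerkRate C) (S.multRate C) (z t)) (Set.Icc t₀ t₁) t) ↔
      ∀ t ∈ Set.Icc t₀ t₁, z t = S.stateOf (fun τ => (z τ).1) (fun τ => (z τ).2.2.2.2) t ∧
        S.OptimalBH C (fun τ => (z τ).1) (fun τ => (z τ).2.2.2.2) t := by
  have hU : ∀ t ∈ Set.Icc t₀ t₁, (z t).1 ∈ S.U := fun t ht => (hreg t ht).1
  constructor
  · intro h
    generalize hqz : (fun τ => (z τ).1) = q at *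
    generalize hμz : (fun τ => (z τ).2.2.2.2) = μ at *
    have eq₁ : Set.EqOn q (fun t => (z t).1) (Set.Icc t₀ t₁) := fun t _ => (congrFun hqz t).symm
    have eq₅ : Set.EqOn μ (fun t => (z t).2.2.2.2) (Set.Icc t₀ t₁) :=
      fun t _ => (congrFun hμz t).symm
    have hUq : ∀ t ∈ Set.Icc t₀ t₁, q t ∈ S.U := fun t ht => by rw [eq₁ ht]; exact hU t ht
    have d₁ := eqOn_deriv_of_hasDerivWithinAt h01 eq₁ (fun t ht => (h t ht).fst)
      fun t _ => hq.differentiable (by norm_num) t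
    -- The remaining components of `z` are recovered in turn: `u` from `dq/dt = Φ u` through `Ψ Φ =
    -- 1`, then `a` and the jerk by differentiating the previous identity on the interval.
    have eq₂ : Set.EqOn (S.freeVel q) (fun t => (z t).2.1) (Set.Icc t₀ t₁) := fun t ht => by
      funext A
      change (S.Psi (q t) *ᵥ deriv q t) (Sum.inr A) = _
      rw [d₁ ht]
      change (S.Psi (q t) *ᵥ (S.Phi (z t).1 *ᵥ embed (z t).2.1)) (Sum.inr A) = _
      rw [show (z t).1 = q t from (eq₁ ht).symm, Matrix.mulVec_mulVec, S.Psi_mul_Phi (hUq t ht),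
        Matrix.one_mulVec]
      rfl
    have eq₃ : Set.EqOn (S.freeAcc q) (fun t => (z t).2.2.1) (Set.Icc t₀ t₁) :=
      eqOn_deriv_of_hasDerivWithinAt h01 eq₂ (fun t ht => (h t ht).snd.fst)
        fun t ht => (S.hasDerivAt_freeVel hq (hUq t ht)).differentiableAt
    have eq₄ : Set.EqOn (S.freeJerk q) (fun t => (z t).2.2.2.1) (Set.Icc t₀ t₁) :=
      eqOn_deriv_of_hasDerivWithinAt h01 eq₃ (fun t ht => (h t ht).snd.snd.fst)
        fun t ht => (S.hasDerivAt_freeAcc hq (hUq t ht)).differentiableAt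
    have d₄ := eqOn_deriv_of_hasDerivWithinAt h01 eq₄ (fun t ht => (h t ht).snd.snd.snd.fst)
        fun t ht => (S.hasDerivAt_freeJerk hq (hUq t ht)).differentiableAt
    have d₅ := eqOn_deriv_of_hasDerivWithinAt h01 eq₅ (fun t ht => (h t ht).snd.snd.snd.snd)
        fun t _ => hμ.differentiable (by norm_num) t
    have hz : ∀ t ∈ Set.Icc t₀ t₁, z t = S.stateOf q μ t := fun t ht => by
      rw [stateOf, eq₁ ht, eq₂ ht, eq₃ ht, eq₄ ht, eq₅ ht]
    have hk : ∀ t ∈ Set.Icc t₀ t₁, S.Kinematic q t := fun t ht => by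
      unfold Kinematic
      rw [d₁ ht, eq₁ ht, eq₂ ht]
      rfl
    refine fun t ht => ⟨hz t ht, (S.optimalBH_iff_rates hC h01 hq hμ
      (fun t ht => hz t ht ▸ hreg t ht) hk ht).2 ?_⟩
    rw [← hz t ht]
    exact ⟨d₄ ht, d₅ ht⟩
  · intro h t ht
    have := S.hasDerivWithinAt_stateOf hC h01 hq hμ
      (fun t ht => ⟨(h t ht).1 ▸ hreg t ht, (h t ht).2⟩) ht
    rw [← (h t ht).1] at this
    exact this.congr (fun τ hτ => (h τ hτ).1) (h t ht).1

end Curve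

end System

end BoltzmannHamel

namespace BoltzmannHamel

/-! ### Autonomous differential equations on open sets -/

section ODE

variable {E : Type*} [NormedAddCommGroup E] [NormedSpace ℝ E] {v : E → E} {R : Set E}

/-- Solutions of a smooth autonomous equation are smooth. -/
theorem contDiffOn_of_hasDerivAt (hv : ContDiffOn ℝ ∞ v R) {I : Set ℝ} (hI : IsOpen I)
    {z : ℝ → E} (hz : ∀ t ∈ I, HasDerivAt z (v (z t)) t) (hzR : ∀ t ∈ I, z t ∈ R) :
    ContDiffOn ℝ ∞ z I := by
  refine contDiffOn_infty.2 fun k => ?_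
  -- Bootstrap: if `z` is `C^k`, so is `v ∘ z`, which is its derivative, and `z` is `C^{k+1}`.
  induction k with
  | zero => exact contDiffOn_zero.2 fun t ht => (hz t ht).continuousAt.continuousWithinAt
  | succ k ih =>
    push_cast
    refine (contDiffOn_succ_iff_deriv_of_isOpen hI).2
      ⟨fun t ht => (hz t ht).differentiableAt.differentiableWithinAt, by simp, ?_⟩
    exact ((hv.of_le (mod_cast le_top)).comp ih hzR).congr fun t ht => (hz t ht).deriv

/-- Local solutions of a smooth autonomous equation, extended to smooth curves on the real line. -/
theorem exists_contDiff_hasDerivAt [CompleteSpace E] (hv : ContDiffOn ℝ ∞ v R) (hR : IsOpen R)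
    {z₀ : E} (hz₀ : z₀ ∈ R) (t : ℝ) : ∃ ε > 0, ∃ z : ℝ → E, ContDiff ℝ ∞ z ∧ z t = z₀ ∧
      ∀ τ ∈ Set.Icc (t - ε) (t + ε), z τ ∈ R ∧ HasDerivAt z (v (z τ)) τ := by
  have hv₀ : ContDiffAt ℝ 1 v z₀ :=
    (hv.of_le ENat.LEInfty.out).contDiffAt (hR.mem_nhds hz₀)
  obtain ⟨α, hα₀, ε, hε, hα⟩ :=
    hv₀.exists_forall_mem_closedBall_exists_eq_forall_mem_Ioo_hasDerivAt₀ t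
  have hcont : ContinuousAt α t := (hα t ⟨by linarith, by linarith⟩).continuousAt
  obtain ⟨δ', hδ', hball⟩ := Metric.mem_nhds_iff.1
    (hcont.preimage_mem_nhds (hR.mem_nhds (hα₀ ▸ hz₀)))
  set δ := min ε δ' with hδdef
  have hδ : 0 < δ := lt_min hε hδ'
  have hαI : ∀ τ ∈ Metric.ball t δ, HasDerivAt α (v (α τ)) τ := fun τ hτ => by
    rw [Real.ball_eq_Ioo] at hτ
    exact hα τ ⟨by linarith [hτ.1, min_le_left ε δ'], by linarith [hτ.2, min_le_left ε δ']⟩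
  have hαR : ∀ τ ∈ Metric.ball t δ, α τ ∈ R := fun τ hτ =>
    hball (Metric.ball_subset_ball (min_le_right _ _) hτ)
  have hsmooth := contDiffOn_of_hasDerivAt hv Metric.isOpen_ball hαI hαR
  -- The cut-off equals `1` up to radius `δ / 3` and vanishes beyond `δ / 2 < δ`, so the blend with
  -- the constant `z₀` is smooth on all of `ℝ`.
  let φ : ContDiffBump t := ⟨δ / 3, δ / 2, by positivity, by linarith⟩
  have hone : ∀ τ ∈ Metric.ball t (δ / 3),
      (fun τ => z₀ + φ τ • (α τ - z₀)) =ᶠ[nhds τ] α := fun τ hτ => by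
    filter_upwards [Metric.isOpen_ball.mem_nhds hτ] with σ hσ
    rw [φ.one_of_mem_closedBall (Metric.ball_subset_closedBall hσ)]
    simp
  -- Since `δ / 4 < δ / 3`, the blend agrees with `α` near each point of the closed interval and has
  -- the same derivative there.
  refine ⟨δ / 4, by positivity, fun τ => z₀ + φ τ • (α τ - z₀), ?_, by simp [hα₀],
    fun τ hτ => ?_⟩
  · refine contDiff_iff_contDiffAt.2 fun τ => ?_
    by_cases hτ : τ ∈ Metric.ball t δ
    · exact contDiffAt_const.add (φ.contDiff.contDiffAt.smul
        ((hsmooth.contDiffAt (Metric.isOpen_ball.mem_nhds hτ)).sub contDiffAt_const))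
    · have hsupp : τ ∉ tsupport φ := by
        rw [φ.tsupport_eq]
        exact fun h => hτ (Metric.closedBall_subset_ball (by simp only [φ]; linarith) h)
      have hzero : (fun τ => z₀ + φ τ • (α τ - z₀)) =ᶠ[nhds τ] fun _ => z₀ := by
        filter_upwards [notMem_tsupport_iff_eventuallyEq.1 hsupp] with σ hσ
        rw [hσ]
        simp
      exact contDiffAt_const.congr_of_eventuallyEq hzero
  · have hτ' : τ ∈ Metric.ball t (δ / 3) := by
      rw [Real.ball_eq_Ioo]
      exact ⟨by linarith [hτ.1], by linarith [hτ.2]⟩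
    have hτ'' : τ ∈ Metric.ball t δ := Metric.ball_subset_ball (by linarith) hτ'
    have e := (hone τ hτ').self_of_nhds
    beta_reduce at e ⊢
    rw [e]
    exact ⟨hαR τ hτ'', (hαI τ hτ'').congr_of_eventuallyEq (hone τ hτ')⟩

/-- Uniqueness of solutions of a smooth autonomous equation. -/
theorem eqOn_of_hasDerivWithinAt (hv : ContDiffOn ℝ ∞ v R) (hR : IsOpen R) {t₀ t₁ : ℝ}
    {f g : ℝ → E}
    (hf : ∀ t ∈ Set.Icc t₀ t₁, f t ∈ R ∧ HasDerivWithinAt f (v (f t)) (Set.Icc t₀ t₁) t)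
    (hg : ∀ t ∈ Set.Icc t₀ t₁, g t ∈ R ∧ HasDerivWithinAt g (v (g t)) (Set.Icc t₀ t₁) t)
    {t : ℝ} (ht : t ∈ Set.Icc t₀ t₁) (heq : f t = g t) : Set.EqOn f g (Set.Icc t₀ t₁) := by
  have hfc : ContinuousOn f (Set.Icc t₀ t₁) := fun s hs => (hf s hs).2.continuousWithinAt
  have hgc : ContinuousOn g (Set.Icc t₀ t₁) := fun s hs => (hg s hs).2.continuousWithinAt
  have hKc : IsCompact (f '' Set.Icc t₀ t₁ ∪ g '' Set.Icc t₀ t₁) :=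
    (isCompact_Icc.image_of_continuousOn hfc).union (isCompact_Icc.image_of_continuousOn hgc)
  have hKR : f '' Set.Icc t₀ t₁ ∪ g '' Set.Icc t₀ t₁ ⊆ R := by
    rintro x (⟨s, hs, rfl⟩ | ⟨s, hs, rfl⟩)
    exacts [(hf s hs).1, (hg s hs).1]
  -- The two trajectories together form a compact subset of `R`, on which the `C¹` field has one
  -- Lipschitz constant.
  obtain ⟨K, hK⟩ := LocallyLipschitzOn.exists_lipschitzOnWith_of_compact (f := v) hKc
    fun x hx => by
      obtain ⟨K, s, hs, hL⟩ := ((hv.of_le ENat.LEInfty.out).contDiffAt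
        (hR.mem_nhds (hKR hx))).exists_lipschitzOnWith
      exact ⟨K, s, mem_nhdsWithin_of_mem_nhds hs, hL⟩
  have hfs : ∀ s ∈ Set.Icc t₀ t₁, f s ∈ f '' Set.Icc t₀ t₁ ∪ g '' Set.Icc t₀ t₁ :=
    fun s hs => Or.inl ⟨s, hs, rfl⟩
  have hgs : ∀ s ∈ Set.Icc t₀ t₁, g s ∈ f '' Set.Icc t₀ t₁ ∪ g '' Set.Icc t₀ t₁ :=
    fun s hs => Or.inr ⟨s, hs, rfl⟩
  have hlow : ∀ s ∈ Set.Ioc t₀ t, s ∈ Set.Icc t₀ t₁ := fun s hs => ⟨hs.1.le, hs.2.trans ht.2⟩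
  have hupp : ∀ s ∈ Set.Ico t t₁, s ∈ Set.Icc t₀ t₁ := fun s hs => ⟨ht.1.trans hs.1, hs.2.le⟩
  -- Uniqueness is run backwards and forwards from `t`, with left derivatives below `t` and right
  -- derivatives above it; both follow from derivatives within `[t₀, t₁]`.
  have hlow' : ∀ s ∈ Set.Ioc t₀ t, Set.Icc t₀ t₁ ∈ nhdsWithin s (Set.Iic s) := fun s hs =>
    Filter.mem_of_superset (Icc_mem_nhdsLE hs.1) (Set.Icc_subset_Icc le_rfl (hlow s hs).2)
  have hupp' : ∀ s ∈ Set.Ico t t₁, Set.Icc t₀ t₁ ∈ nhdsWithin s (Set.Ici s) := fun s hs =>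
    Filter.mem_of_superset (Icc_mem_nhdsGE hs.2) (Set.Icc_subset_Icc (hupp s hs).1 le_rfl)
  rw [← Set.Icc_union_Icc_eq_Icc ht.1 ht.2]
  refine Set.EqOn.union ?_ ?_
  · exact ODE_solution_unique_of_mem_Icc_left (v := fun _ => v)
      (s := fun _ => f '' Set.Icc t₀ t₁ ∪ g '' Set.Icc t₀ t₁) (fun _ _ => hK)
      (hfc.mono (Set.Icc_subset_Icc_right ht.2))
      (fun s hs => (hf s (hlow s hs)).2.mono_of_mem_nhdsWithin (hlow' s hs))
      (fun s hs => hfs s (hlow s hs)) (hgc.mono (Set.Icc_subset_Icc_right ht.2))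
      (fun s hs => (hg s (hlow s hs)).2.mono_of_mem_nhdsWithin (hlow' s hs))
      (fun s hs => hgs s (hlow s hs)) heq
  · exact ODE_solution_unique_of_mem_Icc_right (v := fun _ => v)
      (s := fun _ => f '' Set.Icc t₀ t₁ ∪ g '' Set.Icc t₀ t₁) (fun _ _ => hK)
      (hfc.mono (Set.Icc_subset_Icc_left ht.1))
      (fun s hs => (hf s (hupp s hs)).2.mono_of_mem_nhdsWithin (hupp' s hs))
      (fun s hs => hfs s (hupp s hs)) (hgc.mono (Set.Icc_subset_Icc_left ht.1))
      (fun s hs => (hg s (hupp s hs)).2.mono_of_mem_nhdsWithin (hupp' s hs))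
      (fun s hs => hgs s (hupp s hs)) heq

end ODE

theorem finrank_state (m r : ℕ) : Module.finrank ℝ (State m r) = 2 * m + 4 * r := by
  simp only [State, Conf, Free, Mult, Idx, Module.finrank_prod, Module.finrank_fintype_fun_eq_card,
    Fintype.card_sum, Fintype.card_fin]
  ring

/-! ### Solutions of the optimal control equations with a prescribed state. -/

namespace System

variable {m r : ℕ} (S : System m r) {C : Conf m r → Free r → Free r → ℝ}

/-- The smooth solution of the first-order equation supplies `q` and `μ` as its outer components;
the equivalence identifies the other components with the derivatives of `q`. -/
theorem exists_solution (hC : ContDiffOn ℝ ∞ (uncurryCost C) (S.U ×ˢ Set.univ))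
    {z₀ : State m r} (hz₀ : z₀ ∈ S.regularStates C) (t : ℝ) : ∃ ε > 0,
      ∃ (q : ℝ → Conf m r) (μ : ℝ → Mult m),
        ContDiff ℝ 4 q ∧ ContDiff ℝ 1 μ ∧ S.stateOf q μ t = z₀ ∧
        ∀ τ ∈ Set.Icc (t - ε) (t + ε), S.stateOf q μ τ ∈ S.regularStates C ∧
          S.OptimalBH C q μ τ := by
  obtain ⟨ε, hε, z, hz, hzt, h⟩ := exists_contDiff_hasDerivAt (S.contDiffOn_firstOrderField hC)
    (S.isOpen_regularStates hC) hz₀ t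
  have hq : ContDiff ℝ 4 (fun τ => (z τ).1) := (contDiff_fst.comp hz).of_le ENat.LEInfty.out
  have hμ : ContDiff ℝ 1 (fun τ => (z τ).2.2.2.2) :=
    (contDiff_snd.comp (contDiff_snd.comp (contDiff_snd.comp
      (contDiff_snd.comp hz)))).of_le ENat.LEInfty.out
  have key := (S.hasDerivWithinAt_firstOrderField_iff hC (by linarith : t - ε < t + ε) hq hμ
    fun τ hτ => (h τ hτ).1).1 fun τ hτ => (h τ hτ).2.hasDerivWithinAt
  refine ⟨ε, hε, _, _, hq, hμ, ?_, fun τ hτ => ⟨?_, (key τ hτ).2⟩⟩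
  · rw [← (key t ⟨by linarith, by linarith⟩).1, hzt]
  · rw [← (key τ hτ).1]
    exact (h τ hτ).1

theorem stateOf_eqOn (hC : ContDiffOn ℝ ∞ (uncurryCost C) (S.U ×ˢ Set.univ)) {t₀ t₁ : ℝ}
    (h01 : t₀ < t₁) {q q' : ℝ → Conf m r} {μ μ' : ℝ → Mult m} (hq : ContDiff ℝ 4 q)
    (hμ : ContDiff ℝ 1 μ) (hq' : ContDiff ℝ 4 q') (hμ' : ContDiff ℝ 1 μ')
    (h : ∀ t ∈ Set.Icc t₀ t₁, S.stateOf q μ t ∈ S.regularStates C ∧ S.OptimalBH C q μ t)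
    (h' : ∀ t ∈ Set.Icc t₀ t₁, S.stateOf q' μ' t ∈ S.regularStates C ∧ S.OptimalBH C q' μ' t)
    {t : ℝ} (ht : t ∈ Set.Icc t₀ t₁) (heq : S.stateOf q μ t = S.stateOf q' μ' t) :
    Set.EqOn (S.stateOf q μ) (S.stateOf q' μ') (Set.Icc t₀ t₁) :=
  eqOn_of_hasDerivWithinAt (S.contDiffOn_firstOrderField hC) (S.isOpen_regularStates hC)
    (fun s hs => ⟨(h s hs).1, S.hasDerivWithinAt_stateOf hC h01 hq hμ h hs⟩)
    (fun s hs => ⟨(h' s hs).1, S.hasDerivWithinAt_stateOf hC h01 hq' hμ' h' hs⟩) ht heq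

end System

end BoltzmannHamel

theorem mainTheorem2 {m n : ℕ} (hmn : m ≤ n)
    (S : BoltzmannHamel.System m (n - m))
    (g : BoltzmannHamel.Conf m (n - m) → BoltzmannHamel.Conf m (n - m) →
      BoltzmannHamel.Free (n - m) → ℝ)
    (hg : ContDiffOn ℝ ∞
      (fun z : BoltzmannHamel.Conf m (n - m) × BoltzmannHamel.Conf m (n - m) ×
        BoltzmannHamel.Free (n - m) => g z.1 z.2.1 z.2.2) (S.U ×ˢ Set.univ)) :
    -- the extremals are the solutions of the Boltzmann-Hamel equations
    (∀ (t₀ t₁ : ℝ), t₀ < t₁ →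
      ∀ (q : ℝ → BoltzmannHamel.Conf m (n - m)) (μ : ℝ → BoltzmannHamel.Mult m),
        ContDiff ℝ 4 q → ContDiff ℝ 1 μ → (∀ t ∈ Set.Icc t₀ t₁, q t ∈ S.U) →
        (S.IsExtremal (S.cost g) t₀ t₁ q μ ↔
          ∀ t ∈ Set.Icc t₀ t₁, S.OptimalBH (S.cost g) q μ t)) ∧
    -- they form a system of `4n - 2m` first-order equations
    Module.finrank ℝ (BoltzmannHamel.State m (n - m)) = 4 * n - 2 * m ∧
    (∃ (J : BoltzmannHamel.State m (n - m) → BoltzmannHamel.Free (n - m))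
       (M : BoltzmannHamel.State m (n - m) → BoltzmannHamel.Mult m),
      IsOpen (S.regularStates (S.cost g)) ∧
      ContDiffOn ℝ ∞ J (S.regularStates (S.cost g)) ∧
      ContDiffOn ℝ ∞ M (S.regularStates (S.cost g)) ∧
      ∀ (t₀ t₁ : ℝ), t₀ < t₁ → ∀ z : ℝ → BoltzmannHamel.State m (n - m),
        ContDiff ℝ 4 (fun t => (z t).1) → ContDiff ℝ 1 (fun t => (z t).2.2.2.2) →
        (∀ t ∈ Set.Icc t₀ t₁, z t ∈ S.regularStates (S.cost g)) →
        ((∀ t ∈ Set.Icc t₀ t₁,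
            HasDerivWithinAt z (S.firstOrderField J M (z t)) (Set.Icc t₀ t₁) t) ↔
          ∀ t ∈ Set.Icc t₀ t₁,
            z t = S.stateOf (fun τ => (z τ).1) (fun τ => (z τ).2.2.2.2) t ∧
            S.OptimalBH (S.cost g) (fun τ => (z τ).1) (fun τ => (z τ).2.2.2.2) t)) ∧
    -- the system is minimal: its solutions correspond to arbitrary initial states
    (∀ z₀ ∈ S.regularStates (S.cost g), ∀ t : ℝ, ∃ ε > 0,
      ∃ (q : ℝ → BoltzmannHamel.Conf m (n - m)) (μ : ℝ → BoltzmannHamel.Mult m),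
        ContDiff ℝ 4 q ∧ ContDiff ℝ 1 μ ∧ S.stateOf q μ t = z₀ ∧
        ∀ τ ∈ Set.Icc (t - ε) (t + ε), S.stateOf q μ τ ∈ S.regularStates (S.cost g) ∧
          S.OptimalBH (S.cost g) q μ τ) ∧
    (∀ (t₀ t₁ : ℝ), t₀ < t₁ →
      ∀ (q q' : ℝ → BoltzmannHamel.Conf m (n - m)) (μ μ' : ℝ → BoltzmannHamel.Mult m),
        ContDiff ℝ 4 q → ContDiff ℝ 1 μ → ContDiff ℝ 4 q' → ContDiff ℝ 1 μ' →
        (∀ t ∈ Set.Icc t₀ t₁, S.stateOf q μ t ∈ S.regularStates (S.cost g) ∧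
          S.OptimalBH (S.cost g) q μ t) →
        (∀ t ∈ Set.Icc t₀ t₁, S.stateOf q' μ' t ∈ S.regularStates (S.cost g) ∧
          S.OptimalBH (S.cost g) q' μ' t) →
        (∃ t ∈ Set.Icc t₀ t₁, S.stateOf q μ t = S.stateOf q' μ' t) →
        ∀ t ∈ Set.Icc t₀ t₁, q t = q' t ∧ μ t = μ' t) ∧
    -- the dynamic Boltzmann-Hamel equations supply the controls
    (∀ (t₀ t₁ : ℝ), t₀ < t₁ →
      ∀ (q : ℝ → BoltzmannHamel.Conf m (n - m)) (Q : ℝ → BoltzmannHamel.Free (n - m)),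
        ContDiff ℝ 4 q → (∀ t ∈ Set.Icc t₀ t₁, q t ∈ S.U) →
        (∀ t ∈ Set.Icc t₀ t₁, S.Kinematic q t) →
        ∀ t ∈ Set.Icc t₀ t₁,
          (S.DynamicBH q Q t ↔ Q t = S.controlForce (q t) (S.freeVel q t) (S.freeAcc q t)) ∧
          (S.DynamicBH q Q t → g (q t) (deriv q t) (Q t) =
            S.cost g (q t) (S.freeVel q t) (S.freeAcc q t))) := by
  have hC : ContDiffOn ℝ ∞ (BoltzmannHamel.uncurryCost (S.cost g)) (S.U ×ˢ Set.univ) :=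
    S.contDiffOn_cost hg
  refine ⟨fun t₀ t₁ h01 q μ hq hμ hU => S.isExtremal_iff hC h01 hq hμ hU, ?_,
    ⟨S.jerkRate (S.cost g), S.multRate (S.cost g), S.isOpen_regularStates hC,
      S.contDiffOn_jerkRate hC, (S.contDiffOn_multRate hC).mono S.regularStates_subset,
      fun t₀ t₁ h01 z hq hμ hreg => S.hasDerivWithinAt_firstOrderField_iff hC h01 hq hμ hreg⟩,
    fun z₀ hz₀ t => S.exists_solution hC hz₀ t, ?_, ?_⟩
  · rw [BoltzmannHamel.finrank_state]
    omega
  · rintro t₀ t₁ h01 q q' μ μ' hq hμ hq' hμ' h h' ⟨t, ht, heq⟩ s hs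
    have := S.stateOf_eqOn hC h01 hq hμ hq' hμ' h h' ht heq hs
    exact ⟨congrArg (fun z => z.1) this, congrArg (fun z => z.2.2.2.2) this⟩
  · intro t₀ t₁ _ q Q hq hU hk t ht
    exact ⟨S.dynamicBH_iff hq Q (hU t ht) (hk t ht),
      S.cost_eq_of_dynamicBH g hq Q (hU t ht) (hk t ht)⟩
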